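/- **Setting.** All spaces are real. For $S\ge 0$, a *tame Banach scale* $(V_s,\|\cdot\|_s)_{0\le s\le S}$ consists of Banach spaces such that $V_{s_2}\subset V_{s_1}$ and $\|\cdot\|_{s_1}\le\|\cdot\|_{s_2}$ on $V_{s_2}$ whenever $0\le s_1\le s_2\le S$, together with continuous linear projections $\Pi(\Lambda)$ on $V_0$, $\Lambda\in[1,\infty)$, with ranges $E(\Lambda)\subset V_S$, such that $\Pi(\Lambda)\Pi(\Lambda')=\Pi(\Lambda')\Pi(\Lambda)=\Pi(\Lambda)$ for $1\le\Lambda\le\Lambda'$ and such that there are constants $A_1,A_2\ge1$ with, for all $0\le s\le S$, $\Lambda\ge1$ and $u\in V_s$, $$\|\Pi(\Lambda)u\|_t\le A_1\Lambda^{(t-s)^+}\|u\|_s\quad(0\le t\le S),\qquad \|(1-\Pi(\Lambda))u\|_t\le A_2\Lambda^{-(s-t)}\|u\|_s\quad(0\le t\le s).$$ Let $(W_s,\|\cdot\|'_s)_{0\le s\le S}$ be another tame Banach scale, with projections $\Pi'(\Lambda)$ and ranges $E'(\Lambda)$. Write $B_s=\{u\in V_s:\|u\|_s<1\}$ and $B'_s(0,r)=\{v\in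 W_s:\|v\|'_s<r\}$. Let $s_0,m,\ell,\ell'\ge0$. A map $F:B_{s_0+m}\to W_{s_0}$ is *$S$-tame differentiable* if for every $u\in B_{s_0+m}$ there is a linear map $DF(u):V_{s_0+m}\to W_{s_0}$, and there is a constant $a>0$, such that for all $s\in[s_0,S-m]$, $u\in B_{s_0+m}\cap V_{s+m}$ and $h\in V_{s+m}$: $DF(u)$ maps $V_{s+m}$ continuously into $W_s$; $F(u+th)-F(u)\in W_s$ for all small $t\neq 0$ and $\lim_{t\to0}\big\|\tfrac1t[F(u+th)-F(u)]-DF(u)h\big\|'_s=0$; and $$\|DF(u)h\|'_s\le a\big(\|h\|_{s+m}+\|u\|_{s+m}\|h\|_{s_0+m}\big).$$ The derivative $DF$ is *tame right-invertible* (with losses $\ell,\ell'$) if there is $b>0$ such that for every $u\in B_{s_0+\max\{m,\ell\}}$ there is a linear map $L(u):W_{s_0+\ell'}\to V_{s_0}$ with $DF(u)L(u)k=k$ for all $k\in W_{s_0+\ell'}$ such that $L(u)k\in V_{s_0+m}$ (where the left side is defined) and such that, for all $s_0\le s\le S-\max\{\ell,\ell'\}$, if $u\in V_{s+\ell}$ and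 $k\in W_{s+\ell'}$, then $L(u)k\in V_s$ and $$\|L(u)k\|_s\le b\big(\|k\|'_{s+\ell'}+\|k\|'_{s_0+\ell'}\|u\|_{s+\ell}\big).$$ **Theorem.** Let $s_0,m,\ell,\ell'\ge0$, $s_1\ge s_0+\max\{m,\ell\}$ and $\delta>s_1+\ell'$. There is a number $S_0$, depending only on $s_0,m,\ell,\ell',s_1,\delta$, such that the following holds for all $S\ge S_0$. Let $F:B_{s_0+m}\to W_{s_0}$ be $S$-tame differentiable between tame Banach scales $(V_s)_{0\le s\le S}$ and $(W_s)_{0\le s\le S}$, with $F(0)=0$ and with $DF$ tame right-invertible with losses $\ell,\ell'$. Assume that for all $\Lambda,\Lambda'\in[1,\infty)$ the map $$u\in B_{s_0+\max\{m,\ell\}}\cap E(\Lambda)\ \longmapsto\ \Pi'(\Lambda')\,DF(u)|_{E(\Lambda)}\in\mathcal L(E(\Lambda),E'(\Lambda'))$$ is continuous, where $E(\Lambda)$ carries $\|\cdot\|_{s_0}$, $E'(\Lambda')$ carries $\|\cdot\|'_{s_0}$, and $\mathcal L(E(\Lambda),E'(\Lambda'))$ the operator norm. Then there are $r>0$ and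 a map $G:B'_\delta(0,r)\to B_{s_1}$, continuous for the norms $\|\cdot\|'_\delta$ and $\|\cdot\|_{s_1}$, such that $G(0)=0$, $F(G(v))=v$ and $$\|G(v)\|_{s_1}\le r^{-1}\|v\|'_\delta\qquad\text{for all }v\in B'_\delta(0,r).$$ -/

import Mathlib

open Filter Topology

/-- A scale of (real) Banach spaces `(V_s, ‖·‖_s)`, `0 ≤ s ≤ S`, with `V_0 = V`. The space `V_s` is
the subspace `space s` of `V`, and `nrm s` is its norm. Values of `space s` for `s ∉ [0, S]`, and of
`nrm s` outside `space s`, carry no meaning. Positivity and definiteness of `nrm s` on `space s`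
follow from `nrm_zero` and `nrm_mono`, which give `‖u‖ ≤ nrm s u`. -/
structure BanachScale (V : Type*) [NormedAddCommGroup V] [NormedSpace ℝ V] (S : ℝ) where
  space : ℝ → Submodule ℝ V
  nrm : ℝ → V → ℝ
  space_zero : space 0 = ⊤
  nrm_zero : ∀ u, nrm 0 u = ‖u‖
  nrm_add_le : ∀ s, 0 ≤ s → s ≤ S → ∀ u ∈ space s, ∀ v ∈ space s,
    nrm s (u + v) ≤ nrm s u + nrm s v
  nrm_smul : ∀ s, 0 ≤ s → s ≤ S → ∀ (c : ℝ), ∀ u ∈ space s, nrm s (c • u) = |c| * nrm s u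
  complete : ∀ s, 0 ≤ s → s ≤ S → ∀ x : ℕ → V, (∀ n, x n ∈ space s) →
    (∀ ε > 0, ∃ N, ∀ p ≥ N, ∀ q ≥ N, nrm s (x p - x q) < ε) →
    ∃ y ∈ space s, Tendsto (fun n => nrm s (x n - y)) atTop (𝓝 0)
  space_anti : ∀ s₁ s₂, 0 ≤ s₁ → s₁ ≤ s₂ → s₂ ≤ S → space s₂ ≤ space s₁
  nrm_mono : ∀ s₁ s₂, 0 ≤ s₁ → s₁ ≤ s₂ → s₂ ≤ S → ∀ u ∈ space s₂, nrm s₁ u ≤ nrm s₂ u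

/-- The open ball of centre `0` and radius `r` in `V_s`. -/
def BanachScale.ball {V : Type*} [NormedAddCommGroup V] [NormedSpace ℝ V] {S : ℝ}
    (X : BanachScale V S) (s r : ℝ) : Set V :=
  {u | u ∈ X.space s ∧ X.nrm s u < r}

/-- A tame Banach scale: a scale of Banach spaces with smoothing projections `Π(Λ)`, `1 ≤ Λ`. -/
structure TameScale (V : Type*) [NormedAddCommGroup V] [NormedSpace ℝ V] (S : ℝ) extends
    BanachScale V S where
  /-- The projections `Π(Λ)`; only the values for `1 ≤ Λ` matter. -/
  proj : ℝ → V →L[ℝ] V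
  /-- The range `E(Λ)` lies in `V_S`. -/
  proj_mem : ∀ Λ, 1 ≤ Λ → ∀ u, proj Λ u ∈ space S
  /-- For `Λ = Λ'` this says that `Π(Λ)` is idempotent. -/
  proj_comp : ∀ Λ Λ', 1 ≤ Λ → Λ ≤ Λ' → ∀ u,
    proj Λ (proj Λ' u) = proj Λ u ∧ proj Λ' (proj Λ u) = proj Λ u
  /-- Polynomial growth. -/
  growth : ∃ A₁ : ℝ, 1 ≤ A₁ ∧ ∀ s, 0 ≤ s → s ≤ S → ∀ Λ, 1 ≤ Λ → ∀ u ∈ space s,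
    ∀ t, 0 ≤ t → t ≤ S → nrm t (proj Λ u) ≤ A₁ * Λ ^ (max (t - s) 0) * nrm s u
  /-- Approximation. -/
  approx : ∃ A₂ : ℝ, 1 ≤ A₂ ∧ ∀ s, 0 ≤ s → s ≤ S → ∀ Λ, 1 ≤ Λ → ∀ u ∈ space s,
    ∀ t, 0 ≤ t → t ≤ s → nrm t (u - proj Λ u) ≤ A₂ * Λ ^ (-(s - t)) * nrm s u

section TameMaps

variable {V W : Type*} [NormedAddCommGroup V] [NormedSpace ℝ V]
  [NormedAddCommGroup W] [NormedSpace ℝ W] {S : ℝ}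

/-- `F`, of which only the restriction to the unit ball `B_{s₀+m}` of `V_{s₀+m}` matters, maps
`B_{s₀+m}` into `W_{s₀}` and is G-differentiable there with derivative `DF`. The linear map `DF(u)`
on the subspace `V_{s₀+m}` is represented by an arbitrary linear extension of it to `V`, and only
its values on `V_{s₀+m}` are ever used. -/
structure GDifferentiable (X : BanachScale V S) (Y : BanachScale W S) (s₀ m : ℝ)
    (F : V → W) (DF : V → V →ₗ[ℝ] W) : Prop where
  maps : ∀ u ∈ X.ball (s₀ + m) 1, F u ∈ Y.space s₀
  deriv_mem : ∀ s, s₀ ≤ s → s ≤ S - m → ∀ u ∈ X.ball (s₀ + m) 1, u ∈ X.space (s + m) →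
    ∀ h ∈ X.space (s + m), DF u h ∈ Y.space s
  deriv_bounded : ∀ s, s₀ ≤ s → s ≤ S - m → ∀ u ∈ X.ball (s₀ + m) 1, u ∈ X.space (s + m) →
    ∃ C : ℝ, ∀ h ∈ X.space (s + m), Y.nrm s (DF u h) ≤ C * X.nrm (s + m) h
  /-- The membership makes the norm in the limit meaningful. -/
  deriv_limit : ∀ s, s₀ ≤ s → s ≤ S - m → ∀ u ∈ X.ball (s₀ + m) 1, u ∈ X.space (s + m) →
    ∀ h ∈ X.space (s + m),
      (∀ᶠ t : ℝ in 𝓝[≠] 0, F (u + t • h) - F u ∈ Y.space s) ∧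
      Tendsto (fun t : ℝ => Y.nrm s (t⁻¹ • (F (u + t • h) - F u) - DF u h)) (𝓝[≠] 0) (𝓝 0)

/-- `F : B_{s₀+m} → W_{s₀}` is `S`-tame differentiable with derivative `DF`. -/
structure STameDifferentiable (X : BanachScale V S) (Y : BanachScale W S) (s₀ m : ℝ)
    (F : V → W) (DF : V → V →ₗ[ℝ] W) : Prop extends GDifferentiable X Y s₀ m F DF where
  tame_direct : ∃ a : ℝ, 0 < a ∧ ∀ s, s₀ ≤ s → s ≤ S - m →
    ∀ u ∈ X.ball (s₀ + m) 1, u ∈ X.space (s + m) → ∀ h ∈ X.space (s + m),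
      Y.nrm s (DF u h) ≤
        a * (X.nrm (s + m) h + X.nrm (s + m) u * X.nrm (s₀ + m) h)

/-- `DF` is tame right-invertible, with losses `ℓ`, `ℓ'`. The linear map `L(u)` on `W_{s₀+ℓ'}` is
represented by an arbitrary linear extension to `W`. As `DF(u)` is only defined on `V_{s₀+m}`, the
identity `DF(u) L(u) k = k` is required for those `k` with `L(u) k ∈ V_{s₀+m}`. -/
def TameRightInvertible (X : BanachScale V S) (Y : BanachScale W S) (s₀ m ℓ ℓ' : ℝ)
    (DF : V → V →ₗ[ℝ] W) : Prop :=
  ∃ b : ℝ, 0 < b ∧ ∀ u ∈ X.ball (s₀ + max m ℓ) 1, ∃ L : W →ₗ[ℝ] V,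
    (∀ k ∈ Y.space (s₀ + ℓ'), L k ∈ X.space s₀) ∧
    (∀ k ∈ Y.space (s₀ + ℓ'), L k ∈ X.space (s₀ + m) → DF u (L k) = k) ∧
    ∀ s, s₀ ≤ s → s ≤ S - max ℓ ℓ' → u ∈ X.space (s + ℓ) → ∀ k ∈ Y.space (s + ℓ'),
      L k ∈ X.space s ∧
      X.nrm s (L k) ≤
        b * (Y.nrm (s + ℓ') k + Y.nrm (s₀ + ℓ') k * X.nrm (s + ℓ) u)

/-- For all `Λ, Λ' ∈ [1, ∞)`, the map `u ↦ Π'(Λ') DF(u)` restricted to `E(Λ)`, from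
`B_{s₀+max(m,ℓ)} ∩ E(Λ)` with the norm `‖·‖_{s₀}` to `𝓛(E(Λ), E'(Λ'))` with the operator norm
for `‖·‖_{s₀}` and `‖·‖'_{s₀}`, is continuous. -/
def ProjectedDerivContinuous (X : TameScale V S) (Y : TameScale W S) (s₀ m ℓ : ℝ)
    (DF : V → V →ₗ[ℝ] W) : Prop :=
  ∀ Λ Λ' : ℝ, 1 ≤ Λ → 1 ≤ Λ' →
    ∀ u ∈ X.ball (s₀ + max m ℓ) 1, u ∈ (X.proj Λ).range →
    ∀ ε > 0, ∃ η > 0, ∀ u' ∈ X.ball (s₀ + max m ℓ) 1, u' ∈ (X.proj Λ).range →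
      X.nrm s₀ (u' - u) < η →
      ∀ h ∈ (X.proj Λ).range,
        Y.nrm s₀ (Y.proj Λ' (DF u' h) - Y.proj Λ' (DF u h)) ≤ ε * X.nrm s₀ h

end TameMaps

/-!
The equation `F(u) = v` is solved by a sequence of Galerkin problems. With `u_0 = 0`, one has
`u_n ∈ E(M_n)` and, for `n ≥ 1`, `Π'(N_n) F(u_n) = Π'(T_n) v`, where `T_{n+1} = T_n ^ θ` with
`θ > 1` close to `1`, and `N_n = T_n ^ θ`, `M_n = T_n ^ θ ^ 2`. One then looks for
`u_{n+1} ∈ E(M_{n+1})`, near `u_n`, with `Π'(N_{n+1}) F(u_{n+1}) = Π'(T_{n+1}) v`. The derivative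
of `F` enters only to first order, so no bound on a second derivative is needed.

The derivative of the projected map has `Π(M) L(u)` as approximate right inverse: the error is
`-Π'(N) DF(u) (1 - Π(M)) L(u)`, which is small because `N ≪ M`, as long as the norm of `u` in a
space `V_σ` of high regularity stays under control (`GalerkinSetting.exists_approx_inverse`).
Sizes are measured in mixed norms `‖u‖_{s₀} + T ^ (-τ) ‖u‖_σ`, which control both the size of the
correction and the growth of the `σ`-norm; interpolation then gives geometric decay of the
corrections in `V_{s₁}` (`GalerkinSetting.correction_le`, `GalerkinSetting.exists_next_stage`).

The projected problems are solved by a general statement on `C¹` maps `f` between Banach spaces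
whose derivatives have uniformly bounded approximate right inverses
(`IsApproxSubmersion.exists_continuousOn_solution`). A partition of unity turns these inverses into
a continuous family `L(u)`, and yields a continuous radius on which the first order expansion of `f`
is accurate. The damped Newton step `u + s(u, w) L(u) (w - f(u))`, whose step size `s > 0` is
dictated by this radius, is continuous in `(u, w)`. It decreases the error `‖w - f(u)‖`, and the
decrease controls the length of the step. Hence the iteration converges; the limit has error zero,
because the step sizes converge to a positive number; and it depends continuously on the data,
because the distance from an iterate to the limit is bounded by the error of the iterate.

The corrections decay uniformly in `v`, so the limit of the `u_n` depends continuously on `v`. It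
solves the equation, as `F(u_n) → v` in `W_{s₀}` and `F` is Lipschitz from `V_{s₀+m}` to `W_{s₀}`
(`GalerkinSetting.exists_continuous_right_inverse`). The hypothesis `δ > s₁ + ℓ'` leaves room for
exponents with all these properties (`exists_galerkinExponents`).
-/

/-! ### Continuous local right inverses of approximately invertible maps -/

/-- `f` is a `C¹` map on the open set `Ω`, with derivative `A`, and at each point of `Ω` the
derivative has an approximate right inverse which is bounded by `C`, uniformly on `Ω`. Sizes are
measured by the auxiliary norms `Q` and `q`, which are equivalent to the given ones; the constants
`C` and `1 / 4` do not involve the equivalence constant `c`. -/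
structure IsApproxSubmersion {E Y : Type*} [NormedAddCommGroup E] [NormedSpace ℝ E]
    [NormedAddCommGroup Y] [NormedSpace ℝ Y] (Q : Seminorm ℝ E) (q : Seminorm ℝ Y) (c C : ℝ)
    (Ω : Set E) (f : E → Y) (A : E → E →ₗ[ℝ] Y) : Prop where
  isOpen : IsOpen Ω
  c_pos : 0 < c
  C_pos : 0 < C
  norm_le_Q : ∀ x, ‖x‖ ≤ Q x
  Q_le : ∀ x, Q x ≤ c * ‖x‖
  norm_le_q : ∀ y, ‖y‖ ≤ q y
  q_le : ∀ y, q y ≤ c * ‖y‖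
  continuousOn : ContinuousOn f Ω
  hasDerivAt : ∀ u ∈ Ω, ∀ h, HasDerivAt (fun t : ℝ => f (u + t • h)) (A u h) 0
  deriv_continuous : ∀ u ∈ Ω, ∀ ε > 0, ∃ η > 0, ∀ u' ∈ Ω, ‖u' - u‖ < η →
    ∀ h, ‖A u' h - A u h‖ ≤ ε * ‖h‖
  approx_inverse : ∀ u ∈ Ω, ∃ L : Y →ₗ[ℝ] E, ∀ k, Q (L k) ≤ C * q k ∧
    q (A u (L k) - k) ≤ 1 / 4 * q k

/-- Continuous selection from convex sets on a subset `Ω` of a metric space, when a constant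
selection exists locally. -/
theorem exists_continuousOn_mem_convex_of_local_const {X F : Type*} [PseudoMetricSpace X]
    [NormedAddCommGroup F] [NormedSpace ℝ F] {Ω : Set X} {t : X → Set F}
    (ht : ∀ x ∈ Ω, Convex ℝ (t x)) (H : ∀ x ∈ Ω, ∃ c, ∀ᶠ y in 𝓝[Ω] x, c ∈ t y) :
    ∃ g : X → F, ContinuousOn g Ω ∧ ∀ x ∈ Ω, g x ∈ t x := by
  obtain ⟨g, hg⟩ := exists_continuous_forall_mem_convex_of_local_const (X := Ω)
    (t := fun x => t x) (fun x => ht x x.2) (fun x => by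
      obtain ⟨c, hc⟩ := H x x.2
      refine ⟨c, ?_⟩
      rw [nhdsWithin_eq_map_subtype_coe x.2] at hc
      exact hc)
  classical
  refine ⟨fun x => if hx : x ∈ Ω then g ⟨x, hx⟩ else 0, ?_, ?_⟩
  · rw [continuousOn_iff_continuous_domRestrict]
    convert g.continuous using 1
    ext x
    simp
  · intro x hx
    simpa [hx] using hg ⟨x, hx⟩

namespace IsApproxSubmersion

variable {E Y : Type*} [NormedAddCommGroup E] [NormedSpace ℝ E]
    [NormedAddCommGroup Y] [NormedSpace ℝ Y] {Q : Seminorm ℝ E} {q : Seminorm ℝ Y} {c C : ℝ}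
    {Ω : Set E} {f : E → Y} {A : E → E →ₗ[ℝ] Y}

theorem continuous_Q (H : IsApproxSubmersion Q q c C Ω f A) : Continuous Q :=
  Seminorm.continuous_of_le (q := c.toNNReal • normSeminorm ℝ E)
    (continuous_const.mul continuous_norm)
    (fun x => (H.Q_le x).trans
      (mul_le_mul_of_nonneg_right (Real.le_coe_toNNReal c) (norm_nonneg _)))

theorem continuous_q (H : IsApproxSubmersion Q q c C Ω f A) : Continuous q :=
  Seminorm.continuous_of_le (q := c.toNNReal • normSeminorm ℝ Y)
    (continuous_const.mul continuous_norm)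
    (fun x => (H.q_le x).trans
      (mul_le_mul_of_nonneg_right (Real.le_coe_toNNReal c) (norm_nonneg _)))

/-- Strict differentiability, from the Gateaux derivative and its continuity. -/
theorem norm_remainder_le (H : IsApproxSubmersion Q q c C Ω f A) {u : E} (hu : u ∈ Ω) {ε : ℝ}
    (hε : 0 < ε) : ∃ η > 0, ∀ u', ‖u' - u‖ < η → ∀ h, ‖h‖ < η →
      u' + h ∈ Ω ∧ ‖f (u' + h) - f u' - A u' h‖ ≤ ε * ‖h‖ := by
  obtain ⟨η₀, hη₀, hA⟩ := H.deriv_continuous u hu (ε / 2) (by positivity)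
  obtain ⟨η₁, hη₁, hball⟩ := Metric.isOpen_iff.1 H.isOpen u hu
  have hη : 0 < min η₀ η₁ / 2 := by positivity
  refine ⟨min η₀ η₁ / 2, hη, fun u' hu' h hh => ?_⟩
  have hdist : ∀ t ∈ Set.Icc (0 : ℝ) 1, ‖u' + t • h - u‖ < min η₀ η₁ := by
    intro t ht
    have h1 : u' + t • h - u = (u' - u) + t • h := by abel
    have h2 : ‖t • h‖ ≤ ‖h‖ := by
      rw [norm_smul, Real.norm_of_nonneg ht.1]
      exact mul_le_of_le_one_left (norm_nonneg _) ht.2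
    rw [h1]
    linarith [norm_add_le (u' - u) (t • h)]
  have hmem : ∀ t ∈ Set.Icc (0 : ℝ) 1, u' + t • h ∈ Ω := fun t ht =>
    hball (by
      rw [Metric.mem_ball, dist_eq_norm]
      exact (hdist t ht).trans_le (min_le_right _ _))
  have hu'Ω : u' ∈ Ω := by simpa using hmem 0 (by simp)
  refine ⟨by simpa using hmem 1 (by simp), ?_⟩
  have hd : ∀ t ∈ Set.Icc (0 : ℝ) 1, HasDerivWithinAt
      (fun t : ℝ => f (u' + t • h) - t • A u' h) (A (u' + t • h) h - A u' h)
      (Set.Icc 0 1) t := by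
    intro t ht
    have h1 := H.hasDerivAt _ (hmem t ht) h
    have h2 : HasDerivAt (fun s : ℝ => f (u' + s • h)) (A (u' + t • h) h) t := by
      have h3 : HasDerivAt (fun s : ℝ => s - t) 1 t := (hasDerivAt_id t).sub_const t
      have h4 := HasDerivAt.scomp (h := fun s : ℝ => s - t) t (by simpa using h1) h3
      simp only [one_smul] at h4
      refine h4.congr_of_eventuallyEq (Eventually.of_forall fun s => ?_)
      simp only [Function.comp]
      congr 1
      rw [sub_smul]; abel
    have h5 : HasDerivAt (fun s : ℝ => s • A u' h) (A u' h) t := by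
      simpa using (hasDerivAt_id t).smul_const (A u' h)
    exact (h2.sub h5).hasDerivWithinAt
  have hb : ∀ t ∈ Set.Ico (0 : ℝ) 1, ‖A (u' + t • h) h - A u' h‖ ≤ ε * ‖h‖ := by
    intro t ht
    have ht' : t ∈ Set.Icc (0 : ℝ) 1 := ⟨ht.1, ht.2.le⟩
    have e1 := hA _ (hmem t ht') ((hdist t ht').trans_le (min_le_left _ _)) h
    have e2 := hA u' hu'Ω (hu'.trans_le (by linarith [min_le_left η₀ η₁])) h
    have e3 : A (u' + t • h) h - A u' h =
      (A (u' + t • h) h - A u h) - (A u' h - A u h) := by abel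
    rw [e3]
    linarith [norm_sub_le (A (u' + t • h) h - A u h) (A u' h - A u h)]
  have := norm_image_sub_le_of_norm_deriv_le_segment_01' hd hb
  have e : f (u' + h) - f u' - A u' h =
      (f (u' + (1 : ℝ) • h) - (1 : ℝ) • A u' h) - (f (u' + (0 : ℝ) • h) - (0 : ℝ) • A u' h) := by
    simp only [one_smul, zero_smul, add_zero, sub_zero]; abel
  rw [e]
  exact this

/-- The pointwise approximate right inverses can be replaced by a continuous family. -/
theorem exists_continuousOn_inverse (H : IsApproxSubmersion Q q c C Ω f A) :
    ∃ L : E → Y →L[ℝ] E, ContinuousOn L Ω ∧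
      ∀ u ∈ Ω, ∀ k, Q (L u k) ≤ C * q k ∧ q (A u (L u k) - k) ≤ 1 / 2 * q k := by
  refine exists_continuousOn_mem_convex_of_local_const (Ω := Ω)
    (t := fun u => {L : Y →L[ℝ] E | ∀ k, Q (L k) ≤ C * q k ∧ q (A u (L k) - k) ≤ 1 / 2 * q k})
    ?_ ?_
  · intro u _ L₁ h₁ L₂ h₂ a b ha hb hab k
    refine ⟨?_, ?_⟩
    · calc Q ((a • L₁ + b • L₂) k) = Q (a • L₁ k + b • L₂ k) := rfl
        _ ≤ Q (a • L₁ k) + Q (b • L₂ k) := map_add_le_add _ _ _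
        _ = a * Q (L₁ k) + b * Q (L₂ k) := by
          rw [map_smul_eq_mul, map_smul_eq_mul, Real.norm_of_nonneg ha, Real.norm_of_nonneg hb]
        _ ≤ a * (C * q k) + b * (C * q k) := by
          gcongr
          exacts [(h₁ k).1, (h₂ k).1]
        _ = C * q k := by rw [← add_mul, hab, one_mul]
    · have e : A u ((a • L₁ + b • L₂) k) - k = a • (A u (L₁ k) - k) + b • (A u (L₂ k) - k) := by
        have : (a • L₁ + b • L₂) k = a • L₁ k + b • L₂ k := rfl
        rw [this, map_add, map_smul, map_smul, show b = 1 - a by linarith]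
        module
      calc q (A u ((a • L₁ + b • L₂) k) - k)
          ≤ q (a • (A u (L₁ k) - k)) + q (b • (A u (L₂ k) - k)) := by
            rw [e]; exact map_add_le_add _ _ _
        _ = a * q (A u (L₁ k) - k) + b * q (A u (L₂ k) - k) := by
          rw [map_smul_eq_mul, map_smul_eq_mul, Real.norm_of_nonneg ha, Real.norm_of_nonneg hb]
        _ ≤ a * (1 / 2 * q k) + b * (1 / 2 * q k) := by
          gcongr
          exacts [(h₁ k).2, (h₂ k).2]
        _ = 1 / 2 * q k := by rw [← add_mul, hab, one_mul]
  · intro u hu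
    obtain ⟨L, hL⟩ := H.approx_inverse u hu
    have hC := H.C_pos
    have hc := H.c_pos
    refine ⟨L.mkContinuous (C * c) (fun k => ?_), ?_⟩
    · calc ‖L k‖ ≤ C * q k := (H.norm_le_Q _).trans (hL k).1
        _ ≤ C * (c * ‖k‖) := by gcongr; exact H.q_le k
        _ = C * c * ‖k‖ := by ring
    · obtain ⟨η, hη, hA⟩ := H.deriv_continuous u hu (1 / (4 * (c * C))) (by positivity)
      filter_upwards [self_mem_nhdsWithin, mem_nhdsWithin_of_mem_nhds (Metric.ball_mem_nhds u hη)]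
        with u' hu' hball k
      rw [Metric.mem_ball, dist_eq_norm] at hball
      refine ⟨(hL k).1, ?_⟩
      change q (A u' (L k) - k) ≤ 1 / 2 * q k
      have e : A u' (L k) - k = (A u' (L k) - A u (L k)) + (A u (L k) - k) := by abel
      have h1 : q (A u' (L k) - A u (L k)) ≤ 1 / 4 * q k := by
        calc q (A u' (L k) - A u (L k)) ≤ c * ‖A u' (L k) - A u (L k)‖ := H.q_le _
          _ ≤ c * (1 / (4 * (c * C)) * ‖L k‖) := by gcongr; exact hA u' hu' hball _
          _ ≤ c * (1 / (4 * (c * C)) * (C * q k)) := by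
            gcongr; exact (H.norm_le_Q _).trans (hL k).1
          _ = 1 / 4 * q k := by field_simp
      rw [e]
      linarith [map_add_le_add q (A u' (L k) - A u (L k)) (A u (L k) - k), (hL k).2]

/-- A continuous choice of radii on which the first order expansion of `f` holds. -/
theorem exists_continuousOn_radius (H : IsApproxSubmersion Q q c C Ω f A) {ε : ℝ} (hε : 0 < ε) :
    ∃ R : E → ℝ, ContinuousOn R Ω ∧ ∀ u ∈ Ω, 0 < R u ∧
      ∀ h, Q h ≤ R u → u + h ∈ Ω ∧ q (f (u + h) - f u - A u h) ≤ ε * Q h := by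
  have hc := H.c_pos
  refine exists_continuousOn_mem_convex_of_local_const (Ω := Ω)
    (t := fun u => {R : ℝ | 0 < R ∧
      ∀ h, Q h ≤ R → u + h ∈ Ω ∧ q (f (u + h) - f u - A u h) ≤ ε * Q h}) ?_ ?_
  · intro u _
    refine Set.OrdConnected.convex ⟨fun x hx y hy z hz => ⟨hx.1.trans_le hz.1, fun h hh => ?_⟩⟩
    exact hy.2 h (hh.trans hz.2)
  · intro u hu
    obtain ⟨η, hη, hrem⟩ := H.norm_remainder_le hu (ε := ε / c) (by positivity)
    refine ⟨η / 2, ?_⟩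
    filter_upwards [mem_nhdsWithin_of_mem_nhds (Metric.ball_mem_nhds u hη)] with u' hball
    rw [Metric.mem_ball, dist_eq_norm] at hball
    refine ⟨by positivity, fun h hh => ?_⟩
    obtain ⟨h1, h2⟩ := hrem u' hball h (by linarith [H.norm_le_Q h])
    refine ⟨h1, ?_⟩
    calc q (f (u' + h) - f u' - A u' h) ≤ c * (ε / c * ‖h‖) :=
          (H.q_le _).trans (by gcongr)
      _ = ε * ‖h‖ := by field_simp
      _ ≤ ε * Q h := by gcongr; exact H.norm_le_Q h

/-- A continuous damped Newton step: `Ψ (u, w)` solves `f = w` better than `u` does, and its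
distance to `u` is controlled by the decrease of the error. -/
theorem exists_newton_step (H : IsApproxSubmersion Q q c C Ω f A) :
    ∃ (Ψ : E × Y → E) (s : E × Y → ℝ), ContinuousOn Ψ (Ω ×ˢ Set.univ) ∧
      ContinuousOn s (Ω ×ˢ Set.univ) ∧ ∀ u ∈ Ω, ∀ w, 0 < s (u, w) ∧ Ψ (u, w) ∈ Ω ∧
        q (w - f (Ψ (u, w))) ≤ (1 - s (u, w) / 4) * q (w - f u) ∧
        Q (Ψ (u, w) - u) ≤ 4 * C * (q (w - f u) - q (w - f (Ψ (u, w)))) := by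
  have hC := H.C_pos
  obtain ⟨L, hLc, hL⟩ := H.exists_continuousOn_inverse
  obtain ⟨R, hRc, hR⟩ := H.exists_continuousOn_radius (ε := 1 / (4 * C)) (by positivity)
  have hfst : Set.MapsTo (Prod.fst : E × Y → E) (Ω ×ˢ Set.univ) Ω := fun p hp => hp.1
  have hf : ContinuousOn (fun p : E × Y => p.2 - f p.1) (Ω ×ˢ Set.univ) :=
    continuousOn_snd.sub (H.continuousOn.comp continuousOn_fst hfst)
  have hR' : ContinuousOn (fun p : E × Y => R p.1) (Ω ×ˢ Set.univ) :=
    hRc.comp continuousOn_fst hfst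
  have hL' : ContinuousOn (fun p : E × Y => L p.1) (Ω ×ˢ Set.univ) :=
    hLc.comp continuousOn_fst hfst
  have hpos : ∀ u ∈ Ω, ∀ w, 0 < R u + C * q (w - f u) := fun u hu w =>
    add_pos_of_pos_of_nonneg (hR u hu).1 (mul_nonneg hC.le (apply_nonneg _ _))
  set s : E × Y → ℝ := fun p => R p.1 / (R p.1 + C * q (p.2 - f p.1)) with hs
  have hsc : ContinuousOn s (Ω ×ˢ Set.univ) :=
    hR'.div (hR'.add (continuousOn_const.mul (H.continuous_q.comp_continuousOn hf)))
      (fun p hp => (hpos p.1 hp.1 p.2).ne')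
  refine ⟨fun p => p.1 + s p • L p.1 (p.2 - f p.1), s,
    continuousOn_fst.add (hsc.smul (hL'.clm_apply hf)), hsc, fun u hu w => ?_⟩
  have hs0 : 0 < s (u, w) := div_pos (hR u hu).1 (hpos u hu w)
  have hs1 : s (u, w) ≤ 1 := by
    refine (div_le_one (hpos u hu w)).2 ?_
    linarith [mul_nonneg hC.le (apply_nonneg q (w - f u))]
  have hsR : s (u, w) * (C * q (w - f u)) ≤ R u := by
    simp only [hs]
    rw [div_mul_eq_mul_div, div_le_iff₀ (hpos u hu w)]
    have := (hR u hu).1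
    nlinarith [mul_self_nonneg (R u)]
  simp only
  generalize s (u, w) = σ at hs0 hs1 hsR ⊢
  set e := w - f u with he
  have hQ : Q (σ • L u e) ≤ σ * (C * q e) := by
    rw [map_smul_eq_mul, Real.norm_of_nonneg hs0.le]
    gcongr
    exact (hL u hu e).1
  obtain ⟨hΩ, hrem⟩ := (hR u hu).2 _ (hQ.trans hsR)
  have hrem' : q (f (u + σ • L u e) - f u - A u (σ • L u e)) ≤ σ / 4 * q e :=
    calc _ ≤ 1 / (4 * C) * Q (σ • L u e) := hrem
      _ ≤ 1 / (4 * C) * (σ * (C * q e)) := by gcongr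
      _ = σ / 4 * q e := by field_simp
  have hdec : q (w - f (u + σ • L u e)) ≤ (1 - σ / 4) * q e := by
    have e1 : w - f (u + σ • L u e) = (1 - σ) • e +
        ((-σ) • (A u (L u e) - e) - (f (u + σ • L u e) - f u - A u (σ • L u e))) := by
      have hw : w - f (u + σ • L u e) = e + f u - f (u + σ • L u e) := by rw [he]; abel
      rw [hw, map_smul]
      module
    have h1 : q ((1 - σ) • e) = (1 - σ) * q e := by
      rw [map_smul_eq_mul, Real.norm_of_nonneg (by linarith)]
    have h2 : q ((-σ) • (A u (L u e) - e)) ≤ σ * (1 / 2 * q e) := by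
      rw [map_smul_eq_mul, norm_neg, Real.norm_of_nonneg hs0.le]
      gcongr
      exact (hL u hu e).2
    have h3 := map_add_le_add q ((1 - σ) • e)
      ((-σ) • (A u (L u e) - e) - (f (u + σ • L u e) - f u - A u (σ • L u e)))
    have h4 := map_sub_le_add q ((-σ) • (A u (L u e) - e))
      (f (u + σ • L u e) - f u - A u (σ • L u e))
    rw [← e1] at h3
    linarith
  refine ⟨hs0, hΩ, hdec, ?_⟩
  rw [add_sub_cancel_left]
  nlinarith

/-- A map whose derivative has approximate right inverses has a continuous family of local right
inverses: `g (u, w)` solves `f = w`, near `u`. It depends continuously on `(u, w)` as long as the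
ball in which it is sought lies in `Ω`. -/
theorem exists_continuousOn_solution [CompleteSpace E] (H : IsApproxSubmersion Q q c C Ω f A) :
    ∃ g : E × Y → E,
      ContinuousOn g {p | ∀ u, Q (u - p.1) ≤ 4 * C * q (p.2 - f p.1) → u ∈ Ω} ∧
      ∀ u₀ w, (∀ u, Q (u - u₀) ≤ 4 * C * q (w - f u₀) → u ∈ Ω) →
        f (g (u₀, w)) = w ∧ Q (g (u₀, w) - u₀) ≤ 4 * C * q (w - f u₀) := by
  have hC := H.C_pos
  obtain ⟨Ψ, s, hΨc, hsc, hΨ⟩ := H.exists_newton_step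
  set D : Set (E × Y) := {p | ∀ u, Q (u - p.1) ≤ 4 * C * q (p.2 - f p.1) → u ∈ Ω} with hD
  let U : ℕ → E × Y → E := fun j => Nat.rec (fun p => p.1) (fun _ v p => Ψ (v p, p.2)) j
  have hU0 : ∀ p, U 0 p = p.1 := fun _ => rfl
  have hUs : ∀ j p, U (j + 1) p = Ψ (U j p, p.2) := fun _ _ => rfl
  have hUΩ : ∀ p ∈ D, ∀ j, U j p ∈ Ω := by
    intro p hp j
    induction j with
    | zero => exact hp _ (by rw [hU0, sub_self, map_zero]; positivity)
    | succ j ih => exact (hΨ _ ih p.2).2.1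
  have hUc : ∀ j, ContinuousOn (U j) D := by
    intro j
    induction j with
    | zero => exact continuousOn_fst
    | succ j ih =>
      exact hΨc.comp (ih.prodMk continuousOn_snd) (fun p hp => ⟨hUΩ p hp j, trivial⟩)
  let e : ℕ → E × Y → ℝ := fun j p => q (p.2 - f (U j p))
  have he0 : ∀ j p, 0 ≤ e j p := fun j p => apply_nonneg _ _
  have hec : ∀ j, ContinuousOn (e j) D := fun j =>
    H.continuous_q.comp_continuousOn
      (continuousOn_snd.sub (H.continuousOn.comp (hUc j) fun p hp => hUΩ p hp j))
  have hstep : ∀ p ∈ D, ∀ j, Q (U (j + 1) p - U j p) ≤ 4 * C * (e j p - e (j + 1) p) :=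
    fun p hp j => (hΨ _ (hUΩ p hp j) p.2).2.2.2
  have htel : ∀ p ∈ D, ∀ j k, Q (U (j + k) p - U j p) ≤ 4 * C * (e j p - e (j + k) p) := by
    intro p hp j k
    induction k with
    | zero => simp
    | succ k ih =>
      have h1 := hstep p hp (j + k)
      have h2 : U (j + (k + 1)) p - U j p =
        (U (j + k + 1) p - U (j + k) p) + (U (j + k) p - U j p) := by
          rw [← add_assoc]; abel
      rw [h2, ← add_assoc]
      linarith [map_add_le_add Q (U (j + k + 1) p - U (j + k) p) (U (j + k) p - U j p)]
  have hlim : ∀ p ∈ D, ∃ x, Tendsto (fun j => U j p) atTop (𝓝 x) := by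
    intro p hp
    refine cauchySeq_tendsto_of_complete (cauchySeq_of_summable_dist
      (summable_of_sum_range_le (c := 4 * C * e 0 p) (fun _ => dist_nonneg) fun n => ?_))
    calc ∑ i ∈ Finset.range n, dist (U i p) (U (i + 1) p)
        ≤ ∑ i ∈ Finset.range n, 4 * C * (e i p - e (i + 1) p) := by
          refine Finset.sum_le_sum fun i _ => ?_
          rw [dist_comm, dist_eq_norm]
          exact (H.norm_le_Q _).trans (hstep p hp i)
      _ = 4 * C * (e 0 p - e n p) := by
          rw [← Finset.mul_sum, Finset.sum_range_sub']
      _ ≤ 4 * C * e 0 p := by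
          have := he0 n p
          gcongr
          linarith
  choose! g hg using hlim
  have hgQ : ∀ p ∈ D, ∀ j, Q (g p - U j p) ≤ 4 * C * e j p := by
    intro p hp j
    have h1 : Tendsto (fun k => Q (U (k + j) p - U j p)) atTop (𝓝 (Q (g p - U j p))) :=
      (H.continuous_Q.tendsto _).comp
        ((((tendsto_add_atTop_iff_nat j).2 (hg p hp))).sub_const _)
    refine le_of_tendsto' h1 fun k => ?_
    rw [add_comm k j]
    refine (htel p hp j k).trans ?_
    have := he0 (j + k) p
    gcongr
    linarith
  have hgΩ : ∀ p ∈ D, g p ∈ Ω := fun p hp => hp _ (hgQ p hp 0)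
  have hgt : ∀ p ∈ D, Tendsto (fun j => (U j p, p.2)) atTop (𝓝[Ω ×ˢ Set.univ] (g p, p.2)) :=
    fun p hp => tendsto_nhdsWithin_iff.2 ⟨(hg p hp).prodMk_nhds tendsto_const_nhds,
      Eventually.of_forall fun j => ⟨hUΩ p hp j, trivial⟩⟩
  have het : ∀ p ∈ D, Tendsto (fun j => e j p) atTop (𝓝 (q (p.2 - f (g p)))) := by
    intro p hp
    have h1 : ContinuousWithinAt (fun r : E × Y => q (r.2 - f r.1)) (Ω ×ˢ Set.univ) (g p, p.2) :=
      (H.continuous_q.comp_continuousOn (continuousOn_snd.sub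
        (H.continuousOn.comp continuousOn_fst fun r hr => hr.1))) _ ⟨hgΩ p hp, trivial⟩
    exact h1.tendsto.comp (hgt p hp)
  -- The step sizes converge to a positive number, so a positive limit of the errors is absurd.
  have hzero : ∀ p ∈ D, q (p.2 - f (g p)) = 0 := by
    intro p hp
    have h1 : Tendsto (fun j => s (U j p, p.2)) atTop (𝓝 (s (g p, p.2))) :=
      (hsc _ ⟨hgΩ p hp, trivial⟩).tendsto.comp (hgt p hp)
    have h2 := le_of_tendsto_of_tendsto' ((tendsto_add_atTop_iff_nat 1).2 (het p hp))
      (((h1.div_const 4).const_sub 1).mul (het p hp)) fun j => (hΨ _ (hUΩ p hp j) p.2).2.2.1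
    have h3 := (hΨ _ (hgΩ p hp) p.2).1
    have h4 : 0 ≤ q (p.2 - f (g p)) := apply_nonneg _ _
    nlinarith
  refine ⟨g, ?_, fun u₀ w hp => ⟨?_, hgQ (u₀, w) hp 0⟩⟩
  · intro p hp
    rw [Metric.continuousWithinAt_iff']
    intro ε hε
    have hsmall : ∃ j, 4 * C * e j p < ε / 3 := by
      have h1 := (het p hp).const_mul (4 * C)
      rw [hzero p hp, mul_zero] at h1
      exact (h1.eventually_lt_const (by positivity)).exists
    obtain ⟨j, hj⟩ := hsmall
    have h1 : ∀ᶠ x in 𝓝[D] p, 4 * C * e j x < ε / 3 :=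
      ((hec j p hp).const_mul (4 * C)).eventually_lt_const hj
    have h2 := Metric.continuousWithinAt_iff'.1 (hUc j p hp) (ε / 3) (by positivity)
    filter_upwards [h1, h2, self_mem_nhdsWithin] with x hx1 hx2 hxD
    have h3 := (H.norm_le_Q _).trans (hgQ x hxD j)
    have h4 := (H.norm_le_Q _).trans (hgQ p hp j)
    rw [← dist_eq_norm] at h3 h4
    rw [dist_comm] at h4
    linarith [dist_triangle4 (g x) (U j x) (U j p) (g p)]
  · have h1 := H.norm_le_q (w - f (g (u₀, w)))
    have h2 : q (w - f (g (u₀, w))) = 0 := hzero (u₀, w) hp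
    rw [h2] at h1
    exact (sub_eq_zero.1 (norm_le_zero_iff.1 h1)).symm

end IsApproxSubmersion

/-! ### Norms of a Banach scale -/

namespace BanachScale

variable {V : Type*} [NormedAddCommGroup V] [NormedSpace ℝ V] {S : ℝ} (X : BanachScale V S)

theorem norm_le_nrm {s : ℝ} (h0 : 0 ≤ s) (hS : s ≤ S) {u : V} (hu : u ∈ X.space s) :
    ‖u‖ ≤ X.nrm s u := by
  rw [← X.nrm_zero]
  exact X.nrm_mono 0 s le_rfl h0 hS u hu

theorem nrm_nonneg {s : ℝ} (h0 : 0 ≤ s) (hS : s ≤ S) {u : V} (hu : u ∈ X.space s) :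
    0 ≤ X.nrm s u :=
  (norm_nonneg u).trans (X.norm_le_nrm h0 hS hu)

theorem nrm_zero_vec {s : ℝ} (h0 : 0 ≤ s) (hS : s ≤ S) : X.nrm s 0 = 0 := by
  have := X.nrm_smul s h0 hS 0 0 (Submodule.zero_mem _)
  simpa using this

theorem nrm_neg {s : ℝ} (h0 : 0 ≤ s) (hS : s ≤ S) {u : V} (hu : u ∈ X.space s) :
    X.nrm s (-u) = X.nrm s u := by
  have := X.nrm_smul s h0 hS (-1) u hu
  simpa using this

theorem nrm_sub_le {s : ℝ} (h0 : 0 ≤ s) (hS : s ≤ S) {u v : V} (hu : u ∈ X.space s)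
    (hv : v ∈ X.space s) : X.nrm s (u - v) ≤ X.nrm s u + X.nrm s v := by
  rw [sub_eq_add_neg, ← X.nrm_neg h0 hS hv]
  exact X.nrm_add_le s h0 hS u hu _ (Submodule.neg_mem _ hv)

theorem nrm_le_add_sub {s : ℝ} (h0 : 0 ≤ s) (hS : s ≤ S) {u v : V} (hu : u ∈ X.space s)
    (hv : v ∈ X.space s) : X.nrm s v ≤ X.nrm s u + X.nrm s (v - u) := by
  have := X.nrm_add_le s h0 hS u hu (v - u) (Submodule.sub_mem _ hv hu)
  simpa using this

theorem nrm_smul_add_smul_le {s : ℝ} (h0 : 0 ≤ s) (hS : s ≤ S) {u v : V} (hu : u ∈ X.space s)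
    (hv : v ∈ X.space s) {a b : ℝ} (ha : 0 ≤ a) (hb : 0 ≤ b) :
    X.nrm s (a • u + b • v) ≤ a * X.nrm s u + b * X.nrm s v := by
  have := X.nrm_add_le s h0 hS _ (Submodule.smul_mem _ a hu) _ (Submodule.smul_mem _ b hv)
  rwa [X.nrm_smul s h0 hS a u hu, X.nrm_smul s h0 hS b v hv, abs_of_nonneg ha,
    abs_of_nonneg hb] at this

theorem completeSpace (X : BanachScale V S) (hS : 0 ≤ S) : CompleteSpace V := by
  refine Metric.complete_of_cauchySeq_tendsto fun x hx => ?_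
  obtain ⟨y, -, hy⟩ := X.complete 0 le_rfl hS x (fun n => by simp [X.space_zero]) (by
    intro ε hε
    obtain ⟨N, hN⟩ := Metric.cauchySeq_iff.1 hx ε hε
    refine ⟨N, fun p hp q hq => ?_⟩
    rw [X.nrm_zero, ← dist_eq_norm]
    exact hN p hp q hq)
  refine ⟨y, tendsto_iff_norm_sub_tendsto_zero.2 ?_⟩
  simpa [X.nrm_zero] using hy

/-- The mean value inequality in `V_s`, along a curve in `V` whose increments lie in `V_s`. -/
theorem nrm_image_sub_le {s : ℝ} (h0 : 0 ≤ s) (hS : s ≤ S) {φ : ℝ → V} {K : ℝ} (hK : 0 ≤ K)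
    (h : ∀ t ∈ Set.Icc (0 : ℝ) 1, ∀ ε > 0, ∀ᶠ τ in 𝓝[≠] (0 : ℝ),
      φ (t + τ) - φ t ∈ X.space s ∧ X.nrm s (φ (t + τ) - φ t) ≤ (K + ε) * |τ|) :
    φ 1 - φ 0 ∈ X.space s ∧ X.nrm s (φ 1 - φ 0) ≤ K := by
  have key : ∀ ε > 0, φ 1 - φ 0 ∈ X.space s ∧ X.nrm s (φ 1 - φ 0) ≤ K + ε := by
    intro ε hε
    have hloc : ∀ t ∈ Set.Icc (0 : ℝ) 1, ∃ η > 0, ∀ x, |x - t| < η →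
        φ x - φ t ∈ X.space s ∧ X.nrm s (φ x - φ t) ≤ (K + ε) * |x - t| := by
      intro t ht
      have h1 := h t ht ε hε
      rw [eventually_nhdsWithin_iff, Metric.eventually_nhds_iff] at h1
      obtain ⟨η, hη, h2⟩ := h1
      refine ⟨η, hη, fun x hx => ?_⟩
      rcases eq_or_ne x t with rfl | hne
      · simp [X.nrm_zero_vec h0 hS]
      · have := h2 (y := x - t) (by simpa using hx) (sub_ne_zero.2 hne)
        simpa using this
    -- The bound propagates along `[0, 1]`: the set where it holds is closed and has no last point.
    set P : Set ℝ := {t | φ t - φ 0 ∈ X.space s ∧ X.nrm s (φ t - φ 0) ≤ (K + ε) * t}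
    have hcl : IsClosed (P ∩ Set.Icc 0 1) := by
      refine isClosed_of_closure_subset fun t ht => ?_
      have htI : t ∈ Set.Icc (0 : ℝ) 1 :=
        isClosed_Icc.closure_subset (closure_mono Set.inter_subset_right ht)
      obtain ⟨η, hη, hx⟩ := hloc t htI
      have hnear : ∀ η' > 0, η' ≤ η → φ t - φ 0 ∈ X.space s ∧
          X.nrm s (φ t - φ 0) ≤ (K + ε) * t + (K + ε) * (2 * η') := by
        intro η' hη' hle
        obtain ⟨x, hxP, hxt⟩ := Metric.mem_closure_iff.1 ht η' hη'
        rw [dist_comm, Real.dist_eq] at hxt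
        obtain ⟨h1, h2⟩ := hx x (hxt.trans_le hle)
        have e : φ t - φ 0 = (φ x - φ 0) - (φ x - φ t) := by abel
        refine ⟨by rw [e]; exact Submodule.sub_mem _ hxP.1.1 h1, ?_⟩
        rw [e]
        have h3 := X.nrm_sub_le h0 hS hxP.1.1 h1
        have h4 : x ≤ t + η' := by linarith [le_abs_self (x - t)]
        have h5 : (K + ε) * x ≤ (K + ε) * (t + η') := by gcongr
        have h6 : (K + ε) * |x - t| ≤ (K + ε) * η' := by gcongr
        linarith [hxP.1.2]
      refine ⟨⟨(hnear η hη le_rfl).1, le_of_forall_pos_le_add fun ε' hε' => ?_⟩, htI⟩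
      have hpos : 0 < ε' / (2 * (K + ε)) := by positivity
      refine (hnear (min η (ε' / (2 * (K + ε)))) (lt_min hη hpos) (min_le_left _ _)).2.trans ?_
      have h1 : (K + ε) * (2 * min η (ε' / (2 * (K + ε)))) ≤
          (K + ε) * (2 * (ε' / (2 * (K + ε)))) := by
        gcongr; exact min_le_right _ _
      have h2 : (K + ε) * (2 * (ε' / (2 * (K + ε)))) = ε' := by
        have : K + ε ≠ 0 := by positivity
        field_simp
      linarith
    have hsub := hcl.Icc_subset_of_forall_exists_gt (a := (0 : ℝ)) (b := 1)
      (by simp [P, X.nrm_zero_vec h0 hS]) (by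
        rintro x ⟨hxP, hxI⟩ y hy
        obtain ⟨η, hη, hx⟩ := hloc x ⟨hxI.1, hxI.2.le⟩
        have hy' : x < y := hy
        obtain ⟨z, hz1, hz2⟩ : ∃ z, x < z ∧ z < min y (x + η) :=
          exists_between (lt_min hy' (by linarith))
        have hz3 : |z - x| < η := by
          rw [abs_of_pos (by linarith)]
          linarith [hz2.trans_le (min_le_right _ _)]
        obtain ⟨h1, h2⟩ := hx z hz3
        refine ⟨z, ⟨?_, ?_⟩, hz1, hz2.le.trans (min_le_left _ _)⟩
        · have e : φ z - φ 0 = (φ z - φ x) + (φ x - φ 0) := by abel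
          rw [e]
          exact Submodule.add_mem _ h1 hxP.1
        · have e : φ z - φ 0 = (φ z - φ x) + (φ x - φ 0) := by abel
          rw [e]
          have h3 := X.nrm_add_le s h0 hS _ h1 _ hxP.1
          rw [abs_of_pos (by linarith)] at h2
          linarith [hxP.2])
    simpa [P] using hsub (Set.right_mem_Icc.2 zero_le_one)
  exact ⟨(key 1 one_pos).1, le_of_forall_pos_le_add fun ε hε => (key ε hε).2⟩

end BanachScale

/-! ### Smoothing estimates -/

/-- `A` is a common constant for the growth and approximation properties of the smoothing
projections of `X`. -/
structure TameScale.HasConst {V : Type*} [NormedAddCommGroup V] [NormedSpace ℝ V] {S : ℝ}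
    (X : TameScale V S) (A : ℝ) : Prop where
  growth_ge : ∀ s t, 0 ≤ s → s ≤ t → t ≤ S → ∀ Λ, 1 ≤ Λ → ∀ u ∈ X.space s,
    X.nrm t (X.proj Λ u) ≤ A * Λ ^ (t - s) * X.nrm s u
  growth_le : ∀ s t, 0 ≤ t → t ≤ s → s ≤ S → ∀ Λ, 1 ≤ Λ → ∀ u ∈ X.space s,
    X.nrm t (X.proj Λ u) ≤ A * X.nrm s u
  approx : ∀ s t, 0 ≤ t → t ≤ s → s ≤ S → ∀ Λ, 1 ≤ Λ → ∀ u ∈ X.space s,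
    X.nrm t (u - X.proj Λ u) ≤ A * Λ ^ (-(s - t)) * X.nrm s u

namespace TameScale

variable {V : Type*} [NormedAddCommGroup V] [NormedSpace ℝ V] {S : ℝ} {X : TameScale V S}

theorem exists_hasConst (X : TameScale V S) : ∃ A₀ : ℝ, 1 ≤ A₀ ∧ ∀ A, A₀ ≤ A → X.HasConst A := by
  obtain ⟨A₁, h₁, hg⟩ := X.growth
  obtain ⟨A₂, h₂, ha⟩ := X.approx
  refine ⟨max A₁ A₂, h₁.trans (le_max_left _ _), fun A hA => ⟨?_, ?_, ?_⟩⟩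
  · intro s t hs hst ht Λ hΛ u hu
    have h := hg s hs (hst.trans ht) Λ hΛ u hu t (hs.trans hst) ht
    rw [max_eq_left (by linarith)] at h
    refine h.trans ?_
    have := X.nrm_nonneg hs (hst.trans ht) hu
    gcongr
    exact (le_max_left _ _).trans hA
  · intro s t ht hts hs Λ hΛ u hu
    have h := hg s (ht.trans hts) hs Λ hΛ u hu t ht (hts.trans hs)
    rw [max_eq_right (by linarith), Real.rpow_zero, mul_one] at h
    refine h.trans ?_
    have := X.nrm_nonneg (ht.trans hts) hs hu
    gcongr
    exact (le_max_left _ _).trans hA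
  · intro s t ht hts hs Λ hΛ u hu
    refine (ha s (ht.trans hts) hs Λ hΛ u hu t ht hts).trans ?_
    have := X.nrm_nonneg (ht.trans hts) hs hu
    gcongr
    exact (le_max_right _ _).trans hA

theorem mem_range_iff {Λ : ℝ} (hΛ : 1 ≤ Λ) {u : V} :
    u ∈ (X.proj Λ).range ↔ X.proj Λ u = u := by
  constructor
  · rintro ⟨v, rfl⟩
    exact (X.proj_comp Λ Λ hΛ le_rfl v).1
  · intro h
    exact ⟨u, h⟩

theorem proj_mem_range (Λ : ℝ) (u : V) : X.proj Λ u ∈ (X.proj Λ).range := ⟨u, rfl⟩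

theorem range_mono {Λ Λ' : ℝ} (hΛ : 1 ≤ Λ) (h : Λ ≤ Λ') {u : V} (hu : u ∈ (X.proj Λ).range) :
    u ∈ (X.proj Λ').range := by
  rw [mem_range_iff (hΛ.trans h)]
  rw [mem_range_iff hΛ] at hu
  rw [← hu]
  exact (X.proj_comp Λ Λ' hΛ h u).2

theorem mem_space_of_mem_range {Λ s : ℝ} (hΛ : 1 ≤ Λ) (h0 : 0 ≤ s) (hS : s ≤ S) {u : V}
    (hu : u ∈ (X.proj Λ).range) : u ∈ X.space s := by
  rw [mem_range_iff hΛ] at hu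
  rw [← hu]
  exact X.space_anti s S h0 hS le_rfl (X.proj_mem Λ hΛ u)

theorem isClosed_range {Λ : ℝ} (hΛ : 1 ≤ Λ) : IsClosed ((X.proj Λ).range : Set V) := by
  have : ((X.proj Λ).range : Set V) = {u | X.proj Λ u = u} := by
    ext u
    exact mem_range_iff hΛ
  rw [this]
  exact isClosed_eq (X.proj Λ).continuous continuous_id

theorem nrm_le_of_mem_range {A : ℝ} (hA : X.HasConst A) {Λ s t : ℝ} (hΛ : 1 ≤ Λ) (hs : 0 ≤ s)
    (hst : s ≤ t) (ht : t ≤ S) {u : V} (hu : u ∈ (X.proj Λ).range) :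
    X.nrm t u ≤ A * Λ ^ (t - s) * X.nrm s u := by
  have h1 := hA.growth_ge s t hs hst ht Λ hΛ u
    (mem_space_of_mem_range hΛ hs (hst.trans ht) hu)
  rwa [(mem_range_iff hΛ).1 hu] at h1

/-- Interpolation: split `u` into its low and high frequency parts. -/
theorem nrm_interpolation {A : ℝ} (hA : X.HasConst A) {Λ s t σ : ℝ} (hΛ : 1 ≤ Λ) (hs : 0 ≤ s)
    (hst : s ≤ t) (htσ : t ≤ σ) (hσ : σ ≤ S) {u : V} (hu : u ∈ X.space σ) :
    X.nrm t u ≤ A * Λ ^ (t - s) * X.nrm s u + A * Λ ^ (-(σ - t)) * X.nrm σ u := by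
  have h0t := hs.trans hst
  have htS := htσ.trans hσ
  have hut := X.space_anti t σ h0t htσ hσ hu
  have hus := X.space_anti s t hs hst htS hut
  have h1 := hA.growth_ge s t hs hst htS Λ hΛ u hus
  have h2 := hA.approx σ t h0t htσ hσ Λ hΛ u hu
  have hp : X.proj Λ u ∈ X.space t :=
    mem_space_of_mem_range hΛ h0t htS (proj_mem_range Λ u)
  have h3 := X.nrm_le_add_sub h0t htS hp hut
  linarith

end TameScale

/-! ### Estimates for tame maps -/

section TameMaps

variable {V W : Type*} [NormedAddCommGroup V] [NormedSpace ℝ V]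
  [NormedAddCommGroup W] [NormedSpace ℝ W] {S s₀ m : ℝ}
  {X : BanachScale V S} {Y : BanachScale W S} {F : V → W} {DF : V → V →ₗ[ℝ] W}

/-- The mean value inequality for `F` in `W_s`, on a segment. -/
theorem GDifferentiable.nrm_sub_le (hF : GDifferentiable X Y s₀ m F DF) (hs₀ : 0 ≤ s₀)
    (hm : 0 ≤ m) {s : ℝ} (hs : s₀ ≤ s) (hsS : s ≤ S - m) {u v : V}
    (hu : u ∈ X.ball (s₀ + m) 1) (hus : u ∈ X.space (s + m))
    (hv : v ∈ X.ball (s₀ + m) 1) (hvs : v ∈ X.space (s + m)) {K : ℝ} (hK : 0 ≤ K)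
    (hDF : ∀ t ∈ Set.Icc (0 : ℝ) 1, (1 - t) • u + t • v ∈ X.ball (s₀ + m) 1 →
      Y.nrm s (DF ((1 - t) • u + t • v) (v - u)) ≤ K) :
    F v - F u ∈ Y.space s ∧ Y.nrm s (F v - F u) ≤ K := by
  have hs0 : 0 ≤ s := hs₀.trans hs
  have hsS' : s ≤ S := by linarith
  have := Y.nrm_image_sub_le hs0 hsS' (φ := fun t : ℝ => F ((1 - t) • u + t • v)) hK (by
    intro t ht ε hε
    have hmem : (1 - t) • u + t • v ∈ X.ball (s₀ + m) 1 := by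
      refine ⟨Submodule.add_mem _ (Submodule.smul_mem _ _ hu.1) (Submodule.smul_mem _ _ hv.1), ?_⟩
      have h1 := X.nrm_smul_add_smul_le (by linarith) (by linarith) hu.1 hv.1
        (sub_nonneg.2 ht.2) ht.1
      have h2 := hu.2
      have h3 := hv.2
      rcases eq_or_lt_of_le ht.1 with h | h
      · subst h
        simpa using h2
      · nlinarith [mul_le_mul_of_nonneg_left h2.le (sub_nonneg.2 ht.2),
          mul_lt_mul_of_pos_left h3 h]
    have hmem' : (1 - t) • u + t • v ∈ X.space (s + m) :=
      Submodule.add_mem _ (Submodule.smul_mem _ _ hus) (Submodule.smul_mem _ _ hvs)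
    have hh : v - u ∈ X.space (s + m) := Submodule.sub_mem _ hvs hus
    obtain ⟨h1, h2⟩ := hF.deriv_limit s hs hsS _ hmem hmem' _ hh
    have hD := hF.deriv_mem s hs hsS _ hmem hmem' _ hh
    filter_upwards [h1, h2.eventually_lt_const hε, self_mem_nhdsWithin] with τ hτ1 hτ2 hτ0
    have hτ0' : τ ≠ 0 := hτ0
    have e : (1 - (t + τ)) • u + (t + τ) • v = (1 - t) • u + t • v + τ • (v - u) := by module
    rw [e]
    refine ⟨hτ1, ?_⟩
    set d := F ((1 - t) • u + t • v + τ • (v - u)) - F ((1 - t) • u + t • v)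
    have hd : τ⁻¹ • d ∈ Y.space s := Submodule.smul_mem _ _ hτ1
    have h3 := Y.nrm_le_add_sub hs0 hsS' hD hd
    have h4 : Y.nrm s d = |τ| * Y.nrm s (τ⁻¹ • d) := by
      rw [← Y.nrm_smul s hs0 hsS' τ _ hd, smul_smul, mul_inv_cancel₀ hτ0', one_smul]
    rw [h4, mul_comm]
    gcongr
    linarith [hDF t ht hmem])
  simpa using this

/-- The tame estimate of `DF` in `STameDifferentiable`, with a given constant. -/
def TameDirect (X : BanachScale V S) (Y : BanachScale W S) (s₀ m : ℝ)
    (DF : V → V →ₗ[ℝ] W) (a : ℝ) : Prop :=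
  ∀ s, s₀ ≤ s → s ≤ S - m →
    ∀ u ∈ X.ball (s₀ + m) 1, u ∈ X.space (s + m) → ∀ h ∈ X.space (s + m),
      Y.nrm s (DF u h) ≤ a * (X.nrm (s + m) h + X.nrm (s + m) u * X.nrm (s₀ + m) h)

theorem TameDirect.nrm_le {a : ℝ} (ha : 0 < a) (h : TameDirect X Y s₀ m DF a)
    (hs₀ : 0 ≤ s₀) (hm : 0 ≤ m) (hS : s₀ + m ≤ S) {u : V} (hu : u ∈ X.ball (s₀ + m) 1) {k : V}
    (hk : k ∈ X.space (s₀ + m)) : Y.nrm s₀ (DF u k) ≤ 2 * a * X.nrm (s₀ + m) k := by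
  have h1 := h s₀ le_rfl (by linarith) u hu hu.1 k hk
  have h2 := X.nrm_nonneg (by linarith) hS hk
  have h3 := hu.2
  have h4 : X.nrm (s₀ + m) u * X.nrm (s₀ + m) k ≤ 1 * X.nrm (s₀ + m) k := by gcongr
  calc _ ≤ _ := h1
    _ ≤ a * (X.nrm (s₀ + m) k + 1 * X.nrm (s₀ + m) k) := by gcongr
    _ = _ := by ring

theorem GDifferentiable.nrm_sub_le_of_tameDirect (hF : GDifferentiable X Y s₀ m F DF)
    {a : ℝ} (ha : 0 < a) (hD : TameDirect X Y s₀ m DF a) (hs₀ : 0 ≤ s₀) (hm : 0 ≤ m)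
    (hS : s₀ + m ≤ S) {u v : V} (hu : u ∈ X.ball (s₀ + m) 1) (hv : v ∈ X.ball (s₀ + m) 1) :
    Y.nrm s₀ (F v - F u) ≤ 2 * a * X.nrm (s₀ + m) (v - u) := by
  have hd := Submodule.sub_mem _ hv.1 hu.1
  have h2 := X.nrm_nonneg (by linarith) hS hd
  exact (hF.nrm_sub_le hs₀ hm le_rfl (by linarith) hu hu.1 hv hv.1 (by positivity)
    fun t _ hmem => hD.nrm_le ha hs₀ hm hS hmem hd).2

theorem GDifferentiable.nrm_le_of_tameDirect (hF : GDifferentiable X Y s₀ m F DF)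
    (hF0 : F 0 = 0) {a : ℝ} (ha : 0 < a) (hD : TameDirect X Y s₀ m DF a) (hs₀ : 0 ≤ s₀)
    (hm : 0 ≤ m) {s : ℝ} (hs : s₀ ≤ s) (hsS : s ≤ S - m) {u : V} (hu : u ∈ X.ball (s₀ + m) 1)
    (hus : u ∈ X.space (s + m)) :
    F u ∈ Y.space s ∧ Y.nrm s (F u) ≤ 2 * a * X.nrm (s + m) u := by
  have h1 : 0 ≤ s₀ + m := by linarith
  have h2 : s₀ + m ≤ S := by linarith
  have hz : (0 : V) ∈ X.ball (s₀ + m) 1 :=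
    ⟨Submodule.zero_mem _, by rw [X.nrm_zero_vec h1 h2]; exact one_pos⟩
  have hn := X.nrm_nonneg (by linarith) (by linarith) hus
  have := hF.nrm_sub_le hs₀ hm hs hsS hz (Submodule.zero_mem _) hu hus
    (K := 2 * a * X.nrm (s + m) u) (by positivity) (by
      intro t ht hmem
      simp only [smul_zero, zero_add, sub_zero] at hmem ⊢
      refine (hD s hs hsS _ hmem (Submodule.smul_mem _ _ hus) u hus).trans ?_
      rw [X.nrm_smul _ (by linarith) (by linarith) t u hus, abs_of_nonneg ht.1]
      have h3 := hu.2
      have h4 := X.nrm_nonneg h1 h2 hu.1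
      have h5 : t * X.nrm (s + m) u * X.nrm (s₀ + m) u ≤ 1 * X.nrm (s + m) u * 1 := by
        gcongr
        exact ht.2
      calc _ ≤ a * (X.nrm (s + m) u + 1 * X.nrm (s + m) u * 1) := by gcongr
        _ = _ := by ring)
  simpa [hF0] using this

end TameMaps

/-! ### Exponents and standing hypotheses -/

/-- The exponents of the Galerkin scheme. At stage `T`, the unknown moves from frequencies up to
`T ^ θ ^ 2` to frequencies up to `T ^ θ ^ 3`, the equation is projected on frequencies up to
`T ^ θ ^ 2`, and the right-hand side is smoothed at frequency `T ^ θ`; the stage is followed by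
stage `T ^ θ`. The residual has size `T ^ (-γ)` in the low norm, and the `σ`-norm of the unknown
grows like `T ^ β`; `τ` is the weight of the high norm, and `κ` is a margin which absorbs all
constants when `T` is large. -/
structure GalerkinExponents (s₀ m ℓ ℓ' s₁ δ θ σ κ γ β τ : ℝ) : Prop where
  s₀_nonneg : 0 ≤ s₀
  m_nonneg : 0 ≤ m
  ℓ_nonneg : 0 ≤ ℓ
  ℓ'_nonneg : 0 ≤ ℓ'
  le_s₁ : s₀ + max m ℓ ≤ s₁
  s₁_le : s₁ ≤ σ
  δ_le : δ ≤ σ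
  le_σ : s₀ + m + ℓ' ≤ σ
  one_lt : 1 < θ
  κ_pos : 0 < κ
  γ_eq : γ = δ - s₀ - ℓ'
  τ_eq : τ = θ * β + θ ^ 3 * ℓ
  source_low : β + γ ≤ θ * (σ - m - s₀ - ℓ')
  source_high : θ ^ 2 * (ℓ' + m) + β ≤ τ - γ
  target_high : θ * (σ + ℓ') ≤ τ - γ
  inverse_low : θ ^ 2 * ℓ' + τ + κ ≤ θ ^ 3 * (σ - s₀ - m)
  inverse_high : θ ^ 2 * (σ + ℓ' - s₀) + κ ≤ θ ^ 3 * (σ - s₀ - m)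
  loss_lt : θ ^ 3 * ℓ + κ ≤ γ
  interp_low : θ ^ 2 * (s₁ - s₀) + κ ≤ γ
  interp_high : θ * β + κ ≤ θ ^ 2 * (σ - s₁)
  growth_lt : β + κ ≤ θ * β

/-- The estimates of `TameRightInvertible`, with a given constant. -/
def TameInverse {V W : Type*} [NormedAddCommGroup V] [NormedSpace ℝ V]
    [NormedAddCommGroup W] [NormedSpace ℝ W] {S : ℝ} (X : BanachScale V S) (Y : BanachScale W S)
    (s₀ m ℓ ℓ' : ℝ) (DF : V → V →ₗ[ℝ] W) (b : ℝ) : Prop :=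
  ∀ u ∈ X.ball (s₀ + max m ℓ) 1, ∃ L : W →ₗ[ℝ] V,
    (∀ k ∈ Y.space (s₀ + ℓ'), L k ∈ X.space s₀) ∧
    (∀ k ∈ Y.space (s₀ + ℓ'), L k ∈ X.space (s₀ + m) → DF u (L k) = k) ∧
    ∀ s, s₀ ≤ s → s ≤ S - max ℓ ℓ' → u ∈ X.space (s + ℓ) → ∀ k ∈ Y.space (s + ℓ'),
      L k ∈ X.space s ∧
      X.nrm s (L k) ≤
        b * (Y.nrm (s + ℓ') k + Y.nrm (s₀ + ℓ') k * X.nrm (s + ℓ) u)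

/-- The hypotheses on `F`, with all constants fixed, and exponents adapted to them. -/
structure GalerkinSetting {V W : Type*} [NormedAddCommGroup V] [NormedSpace ℝ V]
    [NormedAddCommGroup W] [NormedSpace ℝ W] {S : ℝ} (X : TameScale V S) (Y : TameScale W S)
    (F : V → W) (DF : V → V →ₗ[ℝ] W) (s₀ m ℓ ℓ' s₁ δ θ σ κ γ β τ A a b : ℝ) : Prop
    extends GalerkinExponents s₀ m ℓ ℓ' s₁ δ θ σ κ γ β τ where
  le_S : σ + m + ℓ + ℓ' ≤ S
  one_le_A : 1 ≤ A
  constX : X.HasConst A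
  constY : Y.HasConst A
  a_pos : 0 < a
  b_pos : 0 < b
  F_zero : F 0 = 0
  gdiff : GDifferentiable X.toBanachScale Y.toBanachScale s₀ m F DF
  direct : TameDirect X.toBanachScale Y.toBanachScale s₀ m DF a
  inverse : TameInverse X.toBanachScale Y.toBanachScale s₀ m ℓ ℓ' DF b
  proj_cont : ProjectedDerivContinuous X Y s₀ m ℓ DF

/-- The norm `‖u‖_s + T ^ (-τ) ‖u‖_t`. -/
noncomputable def BanachScale.mixedNrm {V : Type*} [NormedAddCommGroup V] [NormedSpace ℝ V] {S : ℝ}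
    (X : BanachScale V S) (T τ s t : ℝ) (u : V) : ℝ :=
  X.nrm s u + T ^ (-τ) * X.nrm t u

namespace BanachScale

variable {V : Type*} [NormedAddCommGroup V] [NormedSpace ℝ V] {S : ℝ} (X : BanachScale V S)

/-- `mixedNrm` as a seminorm on a subspace of `V_t`. -/
noncomputable def mixedSeminorm {T s t : ℝ} (τ : ℝ) (hT : 0 ≤ T) (h0 : 0 ≤ s) (hst : s ≤ t)
    (htS : t ≤ S) (p : Submodule ℝ V) (hp : p ≤ X.space t) : Seminorm ℝ p :=
  Seminorm.of (fun u => X.mixedNrm T τ s t u)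
    (fun u v => by
      have hu := hp u.2
      have hv := hp v.2
      have h1 := X.nrm_add_le s h0 (hst.trans htS) u (X.space_anti s t h0 hst htS hu) v
        (X.space_anti s t h0 hst htS hv)
      have h2 := X.nrm_add_le t (h0.trans hst) htS u hu v hv
      have h3 : T ^ (-τ) * X.nrm t (u + v : V) ≤ T ^ (-τ) * (X.nrm t u + X.nrm t v) := by gcongr
      simp only [mixedNrm, Submodule.coe_add]
      linarith)
    (fun c u => by
      have hu := hp u.2
      simp only [mixedNrm, Submodule.coe_smul]
      rw [X.nrm_smul s h0 (hst.trans htS) c u (X.space_anti s t h0 hst htS hu),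
        X.nrm_smul t (h0.trans hst) htS c u hu, Real.norm_eq_abs]
      ring)

end BanachScale

namespace GalerkinSetting

variable {V W : Type*} [NormedAddCommGroup V] [NormedSpace ℝ V]
    [NormedAddCommGroup W] [NormedSpace ℝ W] {S : ℝ} {X : TameScale V S} {Y : TameScale W S}
    {F : V → W} {DF : V → V →ₗ[ℝ] W} {s₀ m ℓ ℓ' s₁ δ θ σ κ γ β τ A a b : ℝ}

/-- The right inverse of `DF(u)`, truncated at frequency `T ^ θ ^ 3`, is an approximate right
inverse of the projected derivative, with bounds in the mixed norms. The error is
`-Π' DF(u) (1 - Π) L(u)`. -/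
theorem exists_approx_inverse
    (H : GalerkinSetting X Y F DF s₀ m ℓ ℓ' s₁ δ θ σ κ γ β τ A a b) {T : ℝ} (hT : 1 ≤ T)
    (hbig : 16 * a * A ^ 3 * b ≤ T ^ κ) {u : V} (hu : u ∈ (X.proj (T ^ θ ^ 3)).range)
    (hu1 : X.nrm (s₀ + max m ℓ) u < 1) (huσ : X.nrm σ u < T ^ (θ * β)) :
    ∃ L : W →ₗ[ℝ] V, ∀ k ∈ (Y.proj (T ^ θ ^ 2)).range,
      X.mixedNrm T τ s₀ σ (X.proj (T ^ θ ^ 3) (L k)) ≤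
        3 * A ^ 2 * b * Y.mixedNrm T τ (s₀ + ℓ') (σ + ℓ') k ∧
      Y.mixedNrm T τ (s₀ + ℓ') (σ + ℓ')
          (Y.proj (T ^ θ ^ 2) (DF u (X.proj (T ^ θ ^ 3) (L k))) - k) ≤
        1 / 4 * Y.mixedNrm T τ (s₀ + ℓ') (σ + ℓ') k := by
  have hs₀ := H.s₀_nonneg
  have hm := H.m_nonneg
  have hℓ := H.ℓ_nonneg
  have hℓ' := H.ℓ'_nonneg
  have hS := H.le_S
  have hA := H.one_le_A
  have ha := H.a_pos
  have hb := H.b_pos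
  have hσ := H.le_σ
  have hs₁ := H.le_s₁
  have hs₁σ := H.s₁_le
  have hθ := H.one_lt
  have hT0 : 0 < T := by linarith
  have hM : 1 ≤ T ^ θ ^ 3 := Real.one_le_rpow hT (by positivity)
  have hN : 1 ≤ T ^ θ ^ 2 := Real.one_le_rpow hT (by positivity)
  have hmaxm := le_max_left m ℓ
  have hmaxℓ := le_max_right m ℓ
  have hmaxS : max ℓ ℓ' ≤ ℓ + ℓ' := max_le (by linarith) (by linarith)
  have huS : ∀ s, 0 ≤ s → s ≤ S → u ∈ X.space s := fun s h0 h1 =>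
    TameScale.mem_space_of_mem_range hM h0 h1 hu
  obtain ⟨L, -, hinv, hLb⟩ := H.inverse u ⟨huS _ (by linarith) (by linarith), hu1⟩
  refine ⟨L, fun k hk => ?_⟩
  have hkS : ∀ s, 0 ≤ s → s ≤ S → k ∈ Y.space s := fun s h0 h1 =>
    TameScale.mem_space_of_mem_range hN h0 h1 hk
  set q := Y.mixedNrm T τ (s₀ + ℓ') (σ + ℓ') k with hq
  have hk1 : 0 ≤ Y.nrm (s₀ + ℓ') k :=
    Y.nrm_nonneg (by linarith) (by linarith) (hkS _ (by linarith) (by linarith))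
  have hk2 : 0 ≤ Y.nrm (σ + ℓ') k :=
    Y.nrm_nonneg (by linarith) (by linarith) (hkS _ (by linarith) (by linarith))
  have hTτ : 0 < T ^ τ := Real.rpow_pos_of_pos hT0 _
  have hTτ' : T ^ τ * T ^ (-τ) = 1 := by
    rw [← Real.rpow_add hT0, add_neg_cancel, Real.rpow_zero]
  have hTn : 0 < T ^ (-τ) := Real.rpow_pos_of_pos hT0 _
  have hqk1 : Y.nrm (s₀ + ℓ') k ≤ q := by
    rw [hq, BanachScale.mixedNrm]
    linarith [mul_nonneg hTn.le hk2]
  have hqk2 : T ^ τ * Y.nrm (s₀ + ℓ') k + Y.nrm (σ + ℓ') k = T ^ τ * q := by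
    rw [hq, BanachScale.mixedNrm, mul_add, ← mul_assoc, hTτ', one_mul]
  have hq0 : 0 ≤ q := hk1.trans hqk1
  -- Low norm of `L k`
  obtain ⟨hL0m, hL0⟩ := hLb s₀ le_rfl (by linarith) (huS _ (by linarith) (by linarith)) k
    (hkS _ (by linarith) (by linarith))
  have hL0' : X.nrm s₀ (L k) ≤ 2 * b * q := by
    have h1 : X.nrm (s₀ + ℓ) u ≤ 1 :=
      (X.nrm_mono (s₀ + ℓ) (s₀ + max m ℓ) (by linarith) (by linarith) (by linarith) u
        (huS _ (by linarith) (by linarith))).trans hu1.le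
    calc X.nrm s₀ (L k) ≤ _ := hL0
      _ ≤ b * (q + q * 1) := by
        have := X.nrm_nonneg (s := s₀ + ℓ) (by linarith) (by linarith)
          (huS _ (by linarith) (by linarith))
        gcongr
      _ = _ := by ring
  -- High norm of `L k`
  obtain ⟨hLσm, hLσ⟩ := hLb σ (by linarith) (by linarith) (huS _ (by linarith) (by linarith)) k
    (hkS _ (by linarith) (by linarith))
  have huℓ : X.nrm (σ + ℓ) u ≤ A * T ^ τ := by
    have h1 := TameScale.nrm_le_of_mem_range H.constX hM (s := σ) (t := σ + ℓ) (by linarith)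
      (by linarith) (by linarith) hu
    have h2 : (T ^ θ ^ 3) ^ (σ + ℓ - σ) = T ^ (θ ^ 3 * ℓ) := by
      rw [← Real.rpow_mul hT0.le, add_sub_cancel_left]
    calc X.nrm (σ + ℓ) u ≤ A * (T ^ θ ^ 3) ^ (σ + ℓ - σ) * T ^ (θ * β) := by
          refine h1.trans ?_
          gcongr
      _ = A * T ^ τ := by
        rw [h2, mul_assoc, ← Real.rpow_add hT0, H.τ_eq, add_comm]
  have hLσ' : X.nrm σ (L k) ≤ A * b * (T ^ τ * q) := by
    calc X.nrm σ (L k) ≤ _ := hLσ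
      _ ≤ b * (Y.nrm (σ + ℓ') k + Y.nrm (s₀ + ℓ') k * (A * T ^ τ)) := by gcongr
      _ ≤ b * (A * Y.nrm (σ + ℓ') k + Y.nrm (s₀ + ℓ') k * (A * T ^ τ)) := by
        gcongr
        exact le_mul_of_one_le_left hk2 hA
      _ = A * b * (T ^ τ * q) := by rw [← hqk2]; ring
  have hLn : 0 ≤ X.nrm σ (L k) := X.nrm_nonneg (by linarith) (by linarith) hLσm
  constructor
  · have h1 := H.constX.growth_le s₀ s₀ hs₀ le_rfl (by linarith) _ hM _ hL0m
    have h2 := H.constX.growth_le σ σ (by linarith) le_rfl (by linarith) _ hM _ hLσm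
    calc X.mixedNrm T τ s₀ σ (X.proj (T ^ θ ^ 3) (L k))
        ≤ A * (2 * b * q) + T ^ (-τ) * (A * (A * b * (T ^ τ * q))) := by
          unfold BanachScale.mixedNrm
          gcongr
          · exact h1.trans (by gcongr)
          · exact h2.trans (by gcongr)
      _ = 2 * A * b * q + (T ^ τ * T ^ (-τ)) * (A ^ 2 * b * q) := by ring
      _ ≤ 3 * A ^ 2 * b * q := by
        rw [hTτ']
        have : A * (b * q) ≤ A ^ 2 * (b * q) := by
          gcongr
          nlinarith
        linarith
  · set h := L k - X.proj (T ^ θ ^ 3) (L k) with hh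
    have hPL : X.proj (T ^ θ ^ 3) (L k) ∈ X.space (s₀ + m) :=
      TameScale.mem_space_of_mem_range hM (by linarith) (by linarith)
        (TameScale.proj_mem_range _ _)
    have hLm : L k ∈ X.space (s₀ + m) :=
      X.space_anti _ _ (by linarith) (by linarith) (by linarith) hLσm
    have hhm : h ∈ X.space (s₀ + m) := Submodule.sub_mem _ hLm hPL
    have hub : u ∈ X.ball (s₀ + m) 1 := ⟨huS _ (by linarith) (by linarith),
      (X.nrm_mono (s₀ + m) (s₀ + max m ℓ) (by linarith) (by linarith) (by linarith) u
        (huS _ (by linarith) (by linarith))).trans_lt hu1⟩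
    have herr : Y.proj (T ^ θ ^ 2) (DF u (X.proj (T ^ θ ^ 3) (L k))) - k =
        -Y.proj (T ^ θ ^ 2) (DF u h) := by
      have h1 : X.proj (T ^ θ ^ 3) (L k) = L k - h := by rw [hh]; abel
      rw [h1, map_sub, hinv k (hkS _ (by linarith) (by linarith)) hLm, map_sub,
        (TameScale.mem_range_iff hN).1 hk]
      abel
    have hDm : DF u h ∈ Y.space s₀ :=
      H.gdiff.deriv_mem s₀ le_rfl (by linarith) u hub hub.1 h hhm
    have hD : Y.nrm s₀ (DF u h) ≤
        2 * a * A ^ 2 * b * (T ^ (-(θ ^ 3 * (σ - s₀ - m)) + τ) * q) := by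
      have h1 := H.direct.nrm_le ha hs₀ hm (by linarith) hub hhm
      have h2 := H.constX.approx σ (s₀ + m) (by linarith) (by linarith) (by linarith) _ hM _ hLσm
      have h3 : (T ^ θ ^ 3) ^ (-(σ - (s₀ + m))) = T ^ (-(θ ^ 3 * (σ - s₀ - m))) := by
        rw [← Real.rpow_mul hT0.le]; congr 1; ring
      calc Y.nrm s₀ (DF u h) ≤ 2 * a * X.nrm (s₀ + m) h := h1
        _ ≤ 2 * a * (A * (T ^ θ ^ 3) ^ (-(σ - (s₀ + m))) * (A * b * (T ^ τ * q))) := by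
          gcongr
          exact h2.trans (by gcongr)
        _ = _ := by rw [h3, Real.rpow_add hT0]; ring
    have hy : Y.proj (T ^ θ ^ 2) (DF u h) ∈ (Y.proj (T ^ θ ^ 2)).range :=
      TameScale.proj_mem_range _ _
    have hyS : ∀ s, 0 ≤ s → s ≤ S → Y.proj (T ^ θ ^ 2) (DF u h) ∈ Y.space s := fun s h0 h1 =>
      TameScale.mem_space_of_mem_range hN h0 h1 hy
    have hκ : 16 * a * A ^ 3 * b * T ^ (-κ) ≤ 1 := by
      have h1 : T ^ κ * T ^ (-κ) = 1 := by
        rw [← Real.rpow_add hT0, add_neg_cancel, Real.rpow_zero]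
      have := Real.rpow_pos_of_pos hT0 (-κ)
      rw [← h1]
      gcongr
    -- Both parts of the mixed norm of the error
    have hpart : ∀ t x, s₀ ≤ t → t ≤ S →
        x + θ ^ 2 * (t - s₀) + τ + κ ≤ θ ^ 3 * (σ - s₀ - m) →
        T ^ x * Y.nrm t (Y.proj (T ^ θ ^ 2) (DF u h)) ≤ 1 / 8 * q := by
      intro t x h1 h2 h3
      have h4 := H.constY.growth_ge s₀ t hs₀ h1 h2 _ hN _ hDm
      have h5 : (T ^ θ ^ 2) ^ (t - s₀) = T ^ (θ ^ 2 * (t - s₀)) := (Real.rpow_mul hT0.le _ _).symm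
      calc T ^ x * Y.nrm t (Y.proj (T ^ θ ^ 2) (DF u h))
          ≤ T ^ x * (A * (T ^ θ ^ 2) ^ (t - s₀) *
            (2 * a * A ^ 2 * b * (T ^ (-(θ ^ 3 * (σ - s₀ - m)) + τ) * q))) := by
            gcongr
            exact h4.trans (by gcongr)
        _ = 2 * a * A ^ 3 * b * q *
            (T ^ x * T ^ (θ ^ 2 * (t - s₀)) * T ^ (-(θ ^ 3 * (σ - s₀ - m)) + τ)) := by
            rw [h5]; ring
        _ ≤ 2 * a * A ^ 3 * b * q * T ^ (-κ) := by
            rw [← Real.rpow_add hT0, ← Real.rpow_add hT0]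
            gcongr
            linarith
        _ = 1 / 8 * q * (16 * a * A ^ 3 * b * T ^ (-κ)) := by ring
        _ ≤ 1 / 8 * q * 1 := by gcongr
        _ = 1 / 8 * q := mul_one _
    have hp1 := hpart (s₀ + ℓ') 0 (by linarith) (by linarith) (by
      rw [add_sub_cancel_left]
      linarith [H.inverse_low])
    have hp2 := hpart (σ + ℓ') (-τ) (by linarith) (by linarith) (by linarith [H.inverse_high])
    rw [Real.rpow_zero, one_mul] at hp1
    rw [herr, BanachScale.mixedNrm, Y.nrm_neg (by linarith) (by linarith)
      (hyS _ (by linarith) (by linarith)), Y.nrm_neg (by linarith) (by linarith)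
      (hyS _ (by linarith) (by linarith))]
    linarith

end GalerkinSetting

/-! ### One Galerkin step -/

namespace GalerkinSetting

variable {V W : Type*} [NormedAddCommGroup V] [NormedSpace ℝ V]
    [NormedAddCommGroup W] [NormedSpace ℝ W] {S : ℝ} {X : TameScale V S} {Y : TameScale W S}
    {F : V → W} {DF : V → V →ₗ[ℝ] W} {s₀ m ℓ ℓ' s₁ δ θ σ κ γ β τ A a b : ℝ}

theorem hasDerivAt_proj (H : GalerkinSetting X Y F DF s₀ m ℓ ℓ' s₁ δ θ σ κ γ β τ A a b)
    (p : W →L[ℝ] W) {u h : V} (hu : u ∈ X.ball (s₀ + m) 1) (hh : h ∈ X.space (s₀ + m)) :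
    HasDerivAt (fun t : ℝ => p (F (u + t • h))) (p (DF u h)) 0 := by
  have hS := H.le_S
  have hσ := H.le_σ
  have hs₀ := H.s₀_nonneg
  have hℓ := H.ℓ_nonneg
  have hℓ' := H.ℓ'_nonneg
  have hm := H.m_nonneg
  obtain ⟨h1, h2⟩ := H.gdiff.deriv_limit s₀ le_rfl (by linarith) u hu hu.1 h hh
  have hD := H.gdiff.deriv_mem s₀ le_rfl (by linarith) u hu hu.1 h hh
  refine p.hasFDerivAt.comp_hasDerivAt (f := fun t : ℝ => F (u + t • h)) 0 ?_
  rw [hasDerivAt_iff_tendsto_slope_zero, tendsto_iff_norm_sub_tendsto_zero]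
  refine squeeze_zero' (Eventually.of_forall fun _ => norm_nonneg _) ?_ h2
  filter_upwards [h1] with t ht
  simp only [zero_add, zero_smul, add_zero]
  exact Y.norm_le_nrm hs₀ (by linarith)
    (Submodule.sub_mem _ (Submodule.smul_mem _ _ ht) hD)

/-- The Galerkin problem at stage `T` with right-hand side `w` is solvable near an approximate
solution `u₀`, provided that the mixed-norm ball in which the solution is sought consists of points
where `exists_approx_inverse` applies. The solution depends continuously on `(u₀, w)`. -/
theorem exists_galerkin_solution
    (H : GalerkinSetting X Y F DF s₀ m ℓ ℓ' s₁ δ θ σ κ γ β τ A a b) {T : ℝ} (hT : 1 ≤ T)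
    (hbig : 16 * a * A ^ 3 * b ≤ T ^ κ) :
    ∃ (g : V × W → V) (D : Set (V × W)), ContinuousOn g D ∧
      ∀ u₀ ∈ (X.proj (T ^ θ ^ 3)).range, ∀ w ∈ (Y.proj (T ^ θ ^ 2)).range,
        (∀ u ∈ (X.proj (T ^ θ ^ 3)).range, X.mixedNrm T τ s₀ σ (u - u₀) ≤ 12 * A ^ 2 * b *
            Y.mixedNrm T τ (s₀ + ℓ') (σ + ℓ') (w - Y.proj (T ^ θ ^ 2) (F u₀)) →
          X.nrm (s₀ + max m ℓ) u < 1 ∧ X.nrm σ u < T ^ (θ * β)) →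
        (u₀, w) ∈ D ∧ g (u₀, w) ∈ (X.proj (T ^ θ ^ 3)).range ∧
          Y.proj (T ^ θ ^ 2) (F (g (u₀, w))) = w ∧
          X.mixedNrm T τ s₀ σ (g (u₀, w) - u₀) ≤ 12 * A ^ 2 * b *
            Y.mixedNrm T τ (s₀ + ℓ') (σ + ℓ') (w - Y.proj (T ^ θ ^ 2) (F u₀)) := by
  have hs₀ := H.s₀_nonneg
  have hm := H.m_nonneg
  have hℓ := H.ℓ_nonneg
  have hℓ' := H.ℓ'_nonneg
  have hS := H.le_S
  have hA := H.one_le_A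
  have ha := H.a_pos
  have hb := H.b_pos
  have hσ := H.le_σ
  have hs₁ := H.le_s₁
  have hs₁σ := H.s₁_le
  have hθ := H.one_lt
  have hT0 : 0 < T := by linarith
  have hM : 1 ≤ T ^ θ ^ 3 := Real.one_le_rpow hT (by positivity)
  have hN : 1 ≤ T ^ θ ^ 2 := Real.one_le_rpow hT (by positivity)
  have hmaxm := le_max_left m ℓ
  have hmaxℓ := le_max_right m ℓ
  have hTn : 0 < T ^ (-τ) := Real.rpow_pos_of_pos hT0 _
  set M := T ^ θ ^ 3 with hMdef
  set N := T ^ θ ^ 2 with hNdef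
  have hE : ∀ {s}, 0 ≤ s → s ≤ S → (X.proj M).range ≤ X.space s := fun h0 h1 u hu =>
    TameScale.mem_space_of_mem_range hM h0 h1 hu
  have hE' : ∀ {s}, 0 ≤ s → s ≤ S → (Y.proj N).range ≤ Y.space s := fun h0 h1 u hu =>
    TameScale.mem_space_of_mem_range hN h0 h1 hu
  have : CompleteSpace V := X.completeSpace (by linarith)
  have : CompleteSpace (X.proj M).range :=
    (TameScale.isClosed_range (X := X) hM).completeSpace_coe
  let Q := X.mixedSeminorm τ hT0.le hs₀ (by linarith : s₀ ≤ σ) (by linarith) (X.proj M).range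
    (hE (by linarith) (by linarith))
  let q := Y.mixedSeminorm τ hT0.le (by linarith : 0 ≤ s₀ + ℓ') (by linarith : s₀ + ℓ' ≤ σ + ℓ')
    (by linarith) (Y.proj N).range (hE' (by linarith) (by linarith))
  let Ω : Set (X.proj M).range :=
    {u | X.nrm (s₀ + max m ℓ) u < 1 ∧ X.nrm σ u < T ^ (θ * β)}
  let pX : V →L[ℝ] (X.proj M).range := (X.proj M).codRestrict _ (fun u => ⟨u, rfl⟩)
  let pY : W →L[ℝ] (Y.proj N).range := (Y.proj N).codRestrict _ (fun u => ⟨u, rfl⟩)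
  let f : (X.proj M).range → (Y.proj N).range := fun u => pY (F u)
  let B : (X.proj M).range → (X.proj M).range →ₗ[ℝ] (Y.proj N).range := fun u =>
    pY.toLinearMap.comp ((DF u).comp (X.proj M).range.subtype)
  -- All norms of the scale are equivalent on the ranges
  have hXeq : ∀ s, 0 ≤ s → s ≤ S → ∀ u ∈ (X.proj M).range, X.nrm s u ≤ A * M ^ S * ‖u‖ := by
    intro s h0 h1 u hu
    have h2 := TameScale.nrm_le_of_mem_range H.constX hM le_rfl h0 h1 hu
    rw [X.nrm_zero, sub_zero] at h2
    refine h2.trans ?_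
    gcongr
  have hYeq : ∀ s, 0 ≤ s → s ≤ S → ∀ u ∈ (Y.proj N).range, Y.nrm s u ≤ A * N ^ S * ‖u‖ := by
    intro s h0 h1 u hu
    have h2 := TameScale.nrm_le_of_mem_range H.constY hN le_rfl h0 h1 hu
    rw [Y.nrm_zero, sub_zero] at h2
    refine h2.trans ?_
    gcongr
  have hcont : ∀ s, 0 ≤ s → s ≤ S → Continuous fun u : (X.proj M).range => X.nrm s u := by
    intro s h0 h1
    refine (LipschitzWith.of_le_add_mul (A * M ^ S).toNNReal fun u v => ?_).continuous
    rw [Real.coe_toNNReal _ (by positivity), dist_eq_norm]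
    have h2 := X.nrm_le_add_sub h0 h1 (hE h0 h1 v.2) (hE h0 h1 u.2)
    have h3 := hXeq s h0 h1 _ (u - v).2
    rw [Submodule.coe_sub] at h3
    change X.nrm s u ≤ X.nrm s v + A * M ^ S * ‖(u - v : V)‖
    linarith
  have hΩball : ∀ u ∈ Ω, (u : V) ∈ X.ball (s₀ + max m ℓ) 1 := fun u hu =>
    ⟨hE (by linarith) (by linarith) u.2, hu.1⟩
  have hΩball' : ∀ u ∈ Ω, (u : V) ∈ X.ball (s₀ + m) 1 := fun u hu =>
    ⟨hE (by linarith) (by linarith) u.2,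
      (X.nrm_mono (s₀ + m) (s₀ + max m ℓ) (by linarith) (by linarith) (by linarith) u
        (hE (by linarith) (by linarith) u.2)).trans_lt hu.1⟩
  have key : IsApproxSubmersion Q q ((1 + T ^ (-τ)) * (A * M ^ S) + (1 + T ^ (-τ)) * (A * N ^ S))
      (3 * A ^ 2 * b) Ω f B := by
    have hMS : 0 < A * M ^ S := by positivity
    have hNS : 0 < A * N ^ S := by positivity
    refine ⟨?_, by positivity, by positivity, ?_, ?_, ?_, ?_, ?_, ?_, ?_, ?_⟩
    · exact (isOpen_lt (hcont _ (by linarith) (by linarith)) continuous_const).inter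
        (isOpen_lt (hcont _ (by linarith) (by linarith)) continuous_const)
    · intro u
      have h1 := X.norm_le_nrm hs₀ (by linarith) (hE hs₀ (by linarith) u.2)
      have h2 := X.nrm_nonneg (s := σ) (by linarith) (by linarith)
        (hE (by linarith) (by linarith) u.2)
      exact h1.trans (le_add_of_nonneg_right (by positivity))
    · intro u
      have h1 := hXeq s₀ hs₀ (by linarith) u u.2
      have h2 := hXeq σ (by linarith) (by linarith) u u.2
      have h3 : T ^ (-τ) * X.nrm σ u ≤ T ^ (-τ) * (A * M ^ S * ‖(u : V)‖) := by gcongr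
      change X.nrm s₀ u + T ^ (-τ) * X.nrm σ u ≤ _ * ‖(u : V)‖
      have h4 : 0 ≤ (1 + T ^ (-τ)) * (A * N ^ S) * ‖(u : V)‖ := by positivity
      linarith
    · intro u
      have h1 := Y.norm_le_nrm (s := s₀ + ℓ') (by linarith) (by linarith)
        (hE' (by linarith) (by linarith) u.2)
      have h2 := Y.nrm_nonneg (s := σ + ℓ') (by linarith) (by linarith)
        (hE' (by linarith) (by linarith) u.2)
      exact h1.trans (le_add_of_nonneg_right (by positivity))
    · intro u
      have h1 := hYeq (s₀ + ℓ') (by linarith) (by linarith) u u.2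
      have h2 := hYeq (σ + ℓ') (by linarith) (by linarith) u u.2
      have h3 : T ^ (-τ) * Y.nrm (σ + ℓ') u ≤ T ^ (-τ) * (A * N ^ S * ‖(u : W)‖) := by gcongr
      change Y.nrm (s₀ + ℓ') u + T ^ (-τ) * Y.nrm (σ + ℓ') u ≤ _ * ‖(u : W)‖
      have h4 : 0 ≤ (1 + T ^ (-τ)) * (A * M ^ S) * ‖(u : W)‖ := by positivity
      linarith
    · refine pY.continuous.comp_continuousOn
        (LipschitzOnWith.continuousOn (K := (2 * a * (A * M ^ S)).toNNReal) ?_)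
      refine LipschitzOnWith.of_dist_le_mul fun u hu v hv => ?_
      rw [Real.coe_toNNReal _ (by positivity), dist_eq_norm, dist_eq_norm]
      have h1 := H.gdiff.nrm_sub_le_of_tameDirect ha H.direct hs₀ hm (by linarith)
        (hΩball' v hv) (hΩball' u hu)
      have h2 := hXeq (s₀ + m) (by linarith) (by linarith) _ (u - v).2
      have h3 := Y.norm_le_nrm hs₀ (by linarith) (Submodule.sub_mem _
        (H.gdiff.maps u (hΩball' u hu)) (H.gdiff.maps v (hΩball' v hv)))
      rw [Submodule.coe_sub] at h2
      calc ‖F u - F v‖ ≤ 2 * a * X.nrm (s₀ + m) (u - v : V) := h3.trans h1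
        _ ≤ 2 * a * (A * M ^ S * ‖(u - v : V)‖) := by gcongr
        _ = 2 * a * (A * M ^ S) * ‖u - v‖ := by
          change _ = 2 * a * (A * M ^ S) * ‖(u - v : V)‖
          ring
    · intro u hu h
      have h1 := H.hasDerivAt_proj (Y.proj N) (hΩball' u hu)
        (hE (by linarith) (by linarith) h.2)
      rw [hasDerivAt_iff_tendsto_slope_zero] at h1 ⊢
      exact tendsto_subtype_rng.2 h1
    · intro u hu ε hε
      obtain ⟨η, hη, hc⟩ := H.proj_cont M N hM hN u (hΩball u hu) u.2 (ε / (A * M ^ S))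
        (by positivity)
      refine ⟨η / (A * M ^ S), by positivity, fun u' hu' hd h => ?_⟩
      have h1 : X.nrm s₀ (u' - u : V) < η := by
        have h2 := hXeq s₀ hs₀ (by linarith) _ (u' - u).2
        rw [Submodule.coe_sub] at h2
        refine h2.trans_lt ?_
        rw [lt_div_iff₀ (by positivity)] at hd
        rw [← Submodule.coe_sub, mul_comm]
        exact hd
      have h2 := hc u' (hΩball u' hu') u'.2 h1 h h.2
      have h3 := Y.norm_le_nrm hs₀ (by linarith) (hE' hs₀ (by linarith) (B u' h - B u h).2)
      calc ‖B u' h - B u h‖ ≤ Y.nrm s₀ (B u' h - B u h : (Y.proj N).range) := h3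
        _ ≤ ε / (A * M ^ S) * X.nrm s₀ h := h2
        _ ≤ ε / (A * M ^ S) * (A * M ^ S * ‖(h : V)‖) := by
          gcongr
          exact hXeq s₀ hs₀ (by linarith) h h.2
        _ = ε * ‖h‖ := by
          rw [← mul_assoc, div_mul_cancel₀ _ hMS.ne']; rfl
    · intro u hu
      obtain ⟨L, hL⟩ := H.exists_approx_inverse hT hbig u.2 hu.1 hu.2
      exact ⟨pX.toLinearMap.comp (L.comp (Y.proj N).range.subtype), fun k => hL k k.2⟩
  obtain ⟨g, hgc, hg⟩ := key.exists_continuousOn_solution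
  have h12 : 4 * (3 * A ^ 2 * b) = 12 * A ^ 2 * b := by ring
  rw [h12] at hgc hg
  refine ⟨fun p => (g (pX p.1, pY p.2) : V),
    (fun p : V × W => (pX p.1, pY p.2)) ⁻¹'
      {p | ∀ u, Q (u - p.1) ≤ 12 * A ^ 2 * b * q (p.2 - f p.1) → u ∈ Ω},
    continuous_subtype_val.comp_continuousOn (hgc.comp (Continuous.continuousOn (by fun_prop))
      (Set.mapsTo_preimage _ _)), ?_⟩
  intro u₀ hu₀ w hw hsub
  have e1 : pX u₀ = ⟨u₀, hu₀⟩ := Subtype.ext ((TameScale.mem_range_iff hM).1 hu₀)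
  have e2 : pY w = ⟨w, hw⟩ := Subtype.ext ((TameScale.mem_range_iff hN).1 hw)
  have h1 : ∀ u, Q (u - ⟨u₀, hu₀⟩) ≤ 12 * A ^ 2 * b * q (⟨w, hw⟩ - f ⟨u₀, hu₀⟩) → u ∈ Ω :=
    fun u hu => hsub u u.2 hu
  obtain ⟨h2, h3⟩ := hg ⟨u₀, hu₀⟩ ⟨w, hw⟩ h1
  simp only [e1, e2]
  refine ⟨?_, (g _).2, congrArg Subtype.val h2, h3⟩
  simp only [Set.mem_preimage, e1, e2]
  exact h1

end GalerkinSetting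

/-! ### Estimates along the Galerkin scheme -/

namespace GalerkinSetting

variable {V W : Type*} [NormedAddCommGroup V] [NormedSpace ℝ V]
    [NormedAddCommGroup W] [NormedSpace ℝ W] {S : ℝ} {X : TameScale V S} {Y : TameScale W S}
    {F : V → W} {DF : V → V →ₗ[ℝ] W} {s₀ m ℓ ℓ' s₁ δ θ σ κ γ β τ A a b : ℝ}

/-- The high frequencies of `F u` are as small as the residual, because `u` is bounded in `V_σ`
and `σ` is large. -/
theorem nrm_sub_proj_map_le (H : GalerkinSetting X Y F DF s₀ m ℓ ℓ' s₁ δ θ σ κ γ β τ A a b)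
    {T ρ t Λ : ℝ} (hT : 1 ≤ T) (hΛ : T ^ θ ≤ Λ) (hρ : 0 ≤ ρ) (ht : 0 ≤ t) (ht' : t ≤ s₀ + ℓ')
    {u : V} (hu : u ∈ X.ball (s₀ + m) 1) (hus : u ∈ X.space σ) (huσ : X.nrm σ u ≤ ρ * T ^ β) :
    Y.nrm t (F u - Y.proj Λ (F u)) ≤ 2 * A * a * (ρ * T ^ (-γ)) := by
  have hs₀ := H.s₀_nonneg
  have hm := H.m_nonneg
  have hℓ := H.ℓ_nonneg
  have hℓ' := H.ℓ'_nonneg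
  have hS := H.le_S
  have hA := H.one_le_A
  have ha := H.a_pos
  have hσ := H.le_σ
  have hθ := H.one_lt
  have hT0 : 0 < T := by linarith
  have hTθ : 1 ≤ T ^ θ := Real.one_le_rpow hT (by linarith)
  have e : σ - m + m = σ := by ring
  obtain ⟨hFm, hF⟩ := H.gdiff.nrm_le_of_tameDirect H.F_zero ha H.direct hs₀ hm (s := σ - m)
    (by linarith) (by linarith) hu (by rwa [e])
  rw [e] at hF
  have h1 := H.constY.approx (σ - m) t ht (by linarith) (by linarith) Λ (hTθ.trans hΛ) _ hFm
  have h2 : Λ ^ (-(σ - m - t)) ≤ T ^ (-(θ * (σ - m - s₀ - ℓ'))) := by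
    calc Λ ^ (-(σ - m - t)) ≤ (T ^ θ) ^ (-(σ - m - t)) :=
          Real.rpow_le_rpow_of_nonpos (by linarith) hΛ (by linarith)
      _ ≤ (T ^ θ) ^ (-(σ - m - s₀ - ℓ')) := Real.rpow_le_rpow_of_exponent_le hTθ (by linarith)
      _ = _ := by rw [← Real.rpow_mul hT0.le]; congr 1; ring
  calc Y.nrm t (F u - Y.proj Λ (F u))
      ≤ A * Λ ^ (-(σ - m - t)) * Y.nrm (σ - m) (F u) := h1
    _ ≤ A * T ^ (-(θ * (σ - m - s₀ - ℓ'))) * (2 * a * (ρ * T ^ β)) := by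
      have := Y.nrm_nonneg (by linarith) (by linarith) hFm
      gcongr
      exact hF.trans (by gcongr)
    _ = 2 * A * a * (ρ * (T ^ (-(θ * (σ - m - s₀ - ℓ'))) * T ^ β)) := by ring
    _ ≤ 2 * A * a * (ρ * T ^ (-γ)) := by
      rw [← Real.rpow_add hT0]
      gcongr
      linarith [H.source_low]

theorem nrm_sub_proj_le (H : GalerkinSetting X Y F DF s₀ m ℓ ℓ' s₁ δ θ σ κ γ β τ A a b)
    {T ρ t Λ : ℝ} (hT : 1 ≤ T) (hΛ : T ≤ Λ) (ht : 0 ≤ t) (ht' : t ≤ s₀ + ℓ')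
    {v : W} (hv : v ∈ Y.space δ) (hvρ : Y.nrm δ v ≤ ρ) :
    Y.nrm t (v - Y.proj Λ v) ≤ A * (ρ * T ^ (-γ)) := by
  have hs₀ := H.s₀_nonneg
  have hm := H.m_nonneg
  have hℓ := H.ℓ_nonneg
  have hℓ' := H.ℓ'_nonneg
  have hS := H.le_S
  have hA := H.one_le_A
  have hδ := H.δ_le
  have hγ := H.γ_eq
  have hθ := H.one_lt
  have hγ0 : 0 ≤ γ := by
    have : 0 ≤ θ ^ 3 * ℓ := by positivity
    linarith [H.loss_lt, H.κ_pos]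
  have h1 := H.constY.approx δ t ht (by linarith) (by linarith) Λ (hT.trans hΛ) v hv
  have h2 : Λ ^ (-(δ - t)) ≤ T ^ (-γ) :=
    (Real.rpow_le_rpow_of_nonpos (by linarith) hΛ (by linarith)).trans
      (Real.rpow_le_rpow_of_exponent_le hT (by linarith))
  calc _ ≤ _ := h1
    _ ≤ A * T ^ (-γ) * ρ := by
      have := Y.nrm_nonneg (s := δ) (by linarith) (by linarith) hv
      gcongr
    _ = _ := by ring

/-- Size of the residual at the beginning of stage `T`. The alternative in the last hypothesis is
needed at the first stage, which starts from `u = 0`. -/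
theorem residual_le (H : GalerkinSetting X Y F DF s₀ m ℓ ℓ' s₁ δ θ σ κ γ β τ A a b)
    {T ρ : ℝ} (hT : 1 ≤ T) (hρ : 0 ≤ ρ) {u : V} {v : W}
    (hu : u ∈ X.ball (s₀ + m) 1) (hus : u ∈ X.space σ) (huσ : X.nrm σ u ≤ ρ * T ^ β)
    (hv : v ∈ Y.space δ) (hvρ : Y.nrm δ v ≤ ρ)
    (huv : Y.proj (T ^ θ) (F u) = Y.proj T v ∨ u = 0 ∧ Y.nrm δ v ≤ ρ * T ^ (-γ)) :
    Y.mixedNrm T τ (s₀ + ℓ') (σ + ℓ') (Y.proj (T ^ θ) v - Y.proj (T ^ θ ^ 2) (F u)) ≤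
      (3 * A + 6 * A * a) * (ρ * T ^ (-γ)) := by
  have hs₀ := H.s₀_nonneg
  have hm := H.m_nonneg
  have hℓ := H.ℓ_nonneg
  have hℓ' := H.ℓ'_nonneg
  have hS := H.le_S
  have hA := H.one_le_A
  have ha := H.a_pos
  have hσ := H.le_σ
  have hθ := H.one_lt
  have hδ := H.δ_le
  have hγ := H.γ_eq
  have hT0 : 0 < T := by linarith
  have hTθ : 1 ≤ T ^ θ := Real.one_le_rpow hT (by linarith)
  have hTle : T ≤ T ^ θ := Real.self_le_rpow_of_one_le hT hθ.le
  have hθ2 : T ^ θ ≤ T ^ θ ^ 2 := Real.rpow_le_rpow_of_exponent_le hT (by nlinarith)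
  have hN : 1 ≤ T ^ θ ^ 2 := hTθ.trans hθ2
  have hγ0 : 0 ≤ γ := by
    have : 0 ≤ θ ^ 3 * ℓ := by positivity
    linarith [H.loss_lt, H.κ_pos]
  have hTγ : 0 < T ^ (-γ) := Real.rpow_pos_of_pos hT0 _
  have hPv : ∀ s, 0 ≤ s → s ≤ S → ∀ Λ, 1 ≤ Λ → ∀ w, Y.proj Λ w ∈ Y.space s :=
    fun s h0 h1 Λ hΛ w => TameScale.mem_space_of_mem_range hΛ h0 h1 (TameScale.proj_mem_range _ _)
  have hδ0 : 0 ≤ δ := by linarith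
  have hFz : Y.nrm (s₀ + ℓ') (Y.proj (T ^ θ) v - Y.proj (T ^ θ ^ 2) (F u)) ≤
      (2 * A + 4 * A * a) * (ρ * T ^ (-γ)) := by
    rcases huv with huv | ⟨rfl, hv0⟩
    · have h0 : 0 ≤ s₀ + ℓ' := by linarith
      have h1 := H.nrm_sub_proj_le hT hTle h0 le_rfl hv hvρ
      have h2 := H.nrm_sub_proj_le hT le_rfl h0 le_rfl hv hvρ
      have h3 := H.nrm_sub_proj_map_le hT le_rfl hρ h0 le_rfl hu hus huσ
      have h4 := H.nrm_sub_proj_map_le hT hθ2 hρ h0 le_rfl hu hus huσ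
      have hvs : v ∈ Y.space (s₀ + ℓ') := Y.space_anti _ _ h0 (by linarith) (by linarith) hv
      have e : σ - m + m = σ := by ring
      have hFs : F u ∈ Y.space (s₀ + ℓ') :=
        Y.space_anti _ (σ - m) h0 (by linarith) (by linarith)
          (H.gdiff.nrm_le_of_tameDirect H.F_zero ha H.direct hs₀ hm (s := σ - m)
            (by linarith) (by linarith) hu (by rwa [e])).1
      have hm1 := Submodule.sub_mem _ hvs (hPv _ h0 (by linarith) _ hTθ v)
      have hm2 := Submodule.sub_mem _ hvs (hPv _ h0 (by linarith) _ hT v)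
      have hm3 := Submodule.sub_mem _ hFs (hPv _ h0 (by linarith) _ hTθ (F u))
      have hm4 := Submodule.sub_mem _ hFs (hPv _ h0 (by linarith) _ hN (F u))
      have e2 : Y.proj (T ^ θ) v - Y.proj (T ^ θ ^ 2) (F u) =
          ((v - Y.proj T v) - (v - Y.proj (T ^ θ) v)) -
            ((F u - Y.proj (T ^ θ) (F u)) - (F u - Y.proj (T ^ θ ^ 2) (F u))) := by
        rw [huv]; abel
      rw [e2]
      have h5 := Y.nrm_sub_le h0 (by linarith) (Submodule.sub_mem _ hm2 hm1)
        (Submodule.sub_mem _ hm3 hm4)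
      have h6 := Y.nrm_sub_le h0 (by linarith) hm2 hm1
      have h7 := Y.nrm_sub_le h0 (by linarith) hm3 hm4
      linarith
    · rw [H.F_zero, map_zero, sub_zero]
      have h1 := H.constY.growth_le δ (s₀ + ℓ') (by linarith) (by linarith) (by linarith) _ hTθ v hv
      calc _ ≤ _ := h1
        _ ≤ A * (ρ * T ^ (-γ)) := by gcongr
        _ ≤ (2 * A + 4 * A * a) * (ρ * T ^ (-γ)) := by
          gcongr
          nlinarith
  have hhigh : T ^ (-τ) * Y.nrm (σ + ℓ') (Y.proj (T ^ θ) v - Y.proj (T ^ θ ^ 2) (F u)) ≤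
      (A + 2 * A * a) * (ρ * T ^ (-γ)) := by
    have e : σ - m + m = σ := by ring
    obtain ⟨hFm, hF⟩ := H.gdiff.nrm_le_of_tameDirect H.F_zero ha H.direct hs₀ hm (s := σ - m)
      (by linarith) (by linarith) hu (by rwa [e])
    rw [e] at hF
    have h1 := H.constY.growth_ge (σ - m) (σ + ℓ') (by linarith) (by linarith) (by linarith) _ hN _
      hFm
    have h2 := H.constY.growth_ge δ (σ + ℓ') hδ0 (by linarith) (by linarith) _ hTθ v hv
    have h3 := Y.nrm_sub_le (by linarith) (by linarith)
      (hPv (σ + ℓ') (by linarith) (by linarith) _ hTθ v)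
      (hPv (σ + ℓ') (by linarith) (by linarith) _ hN (F u))
    have h4 : T ^ (-τ) * Y.nrm (σ + ℓ') (Y.proj (T ^ θ) v) ≤ A * (ρ * T ^ (-γ)) := by
      calc T ^ (-τ) * Y.nrm (σ + ℓ') (Y.proj (T ^ θ) v)
          ≤ T ^ (-τ) * (A * (T ^ θ) ^ (σ + ℓ' - δ) * ρ) := by
            gcongr
            exact h2.trans (by gcongr)
        _ = A * (ρ * (T ^ (-τ) * T ^ (θ * (σ + ℓ' - δ)))) := by
            rw [Real.rpow_mul hT0.le]; ring
        _ ≤ A * (ρ * T ^ (-γ)) := by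
            rw [← Real.rpow_add hT0]
            gcongr
            have : 0 ≤ θ * δ := by positivity
            linarith [H.target_high]
    have h5 : T ^ (-τ) * Y.nrm (σ + ℓ') (Y.proj (T ^ θ ^ 2) (F u)) ≤
        2 * A * a * (ρ * T ^ (-γ)) := by
      calc T ^ (-τ) * Y.nrm (σ + ℓ') (Y.proj (T ^ θ ^ 2) (F u))
          ≤ T ^ (-τ) * (A * (T ^ θ ^ 2) ^ (σ + ℓ' - (σ - m)) * (2 * a * (ρ * T ^ β))) := by
            gcongr
            refine h1.trans ?_
            gcongr
            exact hF.trans (by gcongr)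
        _ = 2 * A * a * (ρ * (T ^ (-τ) * T ^ (θ ^ 2 * (σ + ℓ' - (σ - m))) * T ^ β)) := by
            rw [Real.rpow_mul hT0.le]; ring
        _ ≤ 2 * A * a * (ρ * T ^ (-γ)) := by
            rw [← Real.rpow_add hT0, ← Real.rpow_add hT0]
            gcongr
            have : σ + ℓ' - (σ - m) = ℓ' + m := by ring
            rw [this]
            linarith [H.source_high]
    have hTn : 0 < T ^ (-τ) := Real.rpow_pos_of_pos hT0 _
    nlinarith
  unfold BanachScale.mixedNrm
  linarith

/-- A correction which is small in the mixed norm is small in the `s₁`-norm, by interpolation,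
and in the `σ`-norm. -/
theorem correction_le (H : GalerkinSetting X Y F DF s₀ m ℓ ℓ' s₁ δ θ σ κ γ β τ A a b)
    {T ρ C : ℝ} (hT : 1 ≤ T) (hρ : 0 ≤ ρ) (hC : 0 ≤ C) (hbig : 4 * C ≤ T ^ κ) {z : V}
    (hz : z ∈ X.space σ) (hzQ : X.mixedNrm T τ s₀ σ z ≤ C * (ρ * T ^ (-γ))) :
    X.nrm σ z ≤ 1 / 4 * (ρ * T ^ (θ * β)) ∧ X.nrm s₁ z ≤ (A * C + A) * (ρ * T ^ (-κ)) := by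
  have hs₀ := H.s₀_nonneg
  have hm := H.m_nonneg
  have hℓ := H.ℓ_nonneg
  have hℓ' := H.ℓ'_nonneg
  have hS := H.le_S
  have hA := H.one_le_A
  have hσ := H.le_σ
  have hs₁ := H.le_s₁
  have hs₁σ := H.s₁_le
  have hθ := H.one_lt
  have hmax : 0 ≤ max m ℓ := hm.trans (le_max_left _ _)
  have hT0 : 0 < T := by linarith
  have hz0 := X.nrm_nonneg hs₀ (by linarith)
    (X.space_anti s₀ σ hs₀ (by linarith) (by linarith) hz)
  have hzσ := X.nrm_nonneg (by linarith) (by linarith) hz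
  have hTτ : 0 < T ^ τ := Real.rpow_pos_of_pos hT0 _
  have hTn : 0 < T ^ (-τ) := Real.rpow_pos_of_pos hT0 _
  have hTτ' : T ^ τ * T ^ (-τ) = 1 := by
    rw [← Real.rpow_add hT0, add_neg_cancel, Real.rpow_zero]
  unfold BanachScale.mixedNrm at hzQ
  have hlow : X.nrm s₀ z ≤ C * (ρ * T ^ (-γ)) := by
    linarith [mul_nonneg hTn.le hzσ]
  have hhigh : X.nrm σ z ≤ C * (ρ * T ^ (τ - γ)) := by
    have h1 : T ^ (-τ) * X.nrm σ z ≤ C * (ρ * T ^ (-γ)) := by linarith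
    calc X.nrm σ z = T ^ τ * (T ^ (-τ) * X.nrm σ z) := by rw [← mul_assoc, hTτ', one_mul]
      _ ≤ T ^ τ * (C * (ρ * T ^ (-γ))) := by gcongr
      _ = C * (ρ * (T ^ τ * T ^ (-γ))) := by ring
      _ = _ := by rw [← Real.rpow_add hT0, sub_eq_add_neg]
  have hhigh' : X.nrm σ z ≤ 1 / 4 * (ρ * T ^ (θ * β)) := by
    calc X.nrm σ z ≤ C * (ρ * T ^ (τ - γ)) := hhigh
      _ ≤ 1 / 4 * T ^ κ * (ρ * T ^ (θ * β - κ)) := by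
        have h1 : T ^ (τ - γ) ≤ T ^ (θ * β - κ) := Real.rpow_le_rpow_of_exponent_le hT
          (by rw [H.τ_eq]; linarith [H.loss_lt])
        gcongr
        linarith
      _ = 1 / 4 * (ρ * (T ^ κ * T ^ (θ * β - κ))) := by ring
      _ = _ := by rw [← Real.rpow_add hT0, add_sub_cancel]
  refine ⟨hhigh', ?_⟩
  have hN : 1 ≤ T ^ θ ^ 2 := Real.one_le_rpow hT (by positivity)
  have h1 := TameScale.nrm_interpolation H.constX hN hs₀ (t := s₁) (by linarith) hs₁σ
    (by linarith) hz
  have h2 : A * (T ^ θ ^ 2) ^ (s₁ - s₀) * X.nrm s₀ z ≤ A * C * (ρ * T ^ (-κ)) := by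
    calc _ ≤ A * (T ^ θ ^ 2) ^ (s₁ - s₀) * (C * (ρ * T ^ (-γ))) := by gcongr
      _ = A * C * (ρ * (T ^ (θ ^ 2 * (s₁ - s₀)) * T ^ (-γ))) := by
        rw [Real.rpow_mul hT0.le]; ring
      _ ≤ A * C * (ρ * T ^ (-κ)) := by
        rw [← Real.rpow_add hT0]
        gcongr
        linarith [H.interp_low]
  have h3 : A * (T ^ θ ^ 2) ^ (-(σ - s₁)) * X.nrm σ z ≤ A * (ρ * T ^ (-κ)) := by
    calc _ ≤ A * (T ^ θ ^ 2) ^ (-(σ - s₁)) * (1 * (ρ * T ^ (θ * β))) := by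
          gcongr
          refine hhigh'.trans ?_
          gcongr
          norm_num
      _ = A * (ρ * (T ^ (θ ^ 2 * (-(σ - s₁))) * T ^ (θ * β))) := by
        rw [Real.rpow_mul hT0.le (θ ^ 2)]; ring
      _ ≤ A * (ρ * T ^ (-κ)) := by
        rw [← Real.rpow_add hT0]
        gcongr
        linarith [H.interp_high]
  linarith

/-- The state of the scheme at the beginning of stage `T`: `u` is the current approximate
solution for the right-hand side `v`, and `ρ < 1` measures the size of `v`. -/
structure Stage (X : TameScale V S) (Y : TameScale W S) (F : V → W) (s₁ δ θ σ γ β T ρ : ℝ)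
    (v : W) (u : V) : Prop where
  mem_range : u ∈ (X.proj (T ^ θ ^ 2)).range
  nrm_s₁_le : X.nrm s₁ u ≤ ρ / 2
  nrm_σ_le : X.nrm σ u ≤ ρ * T ^ β
  solves : Y.proj (T ^ θ) (F u) = Y.proj T v ∨ u = 0 ∧ Y.nrm δ v ≤ ρ * T ^ (-γ)

set_option maxHeartbeats 800000 in
/-- Passage from stage `T` to stage `T ^ θ`, continuously in the data. -/
theorem exists_next_stage (H : GalerkinSetting X Y F DF s₀ m ℓ ℓ' s₁ δ θ σ κ γ β τ A a b)
    {C : ℝ} (hC : C = 12 * A ^ 2 * b * (3 * A + 6 * A * a)) {T : ℝ} (hT : 1 ≤ T) (n : ℕ)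
    (hbig : (16 * a * A ^ 3 * b + 4 * C + 4 * (A * C + A)) * 2 ^ n ≤ T ^ κ) :
    ∃ (g : V × W → V) (D : Set (V × W)), ContinuousOn g D ∧
      ∀ ρ u v, 0 ≤ ρ → ρ < 1 → v ∈ Y.space δ → Y.nrm δ v ≤ ρ →
        Stage X Y F s₁ δ θ σ γ β T ρ v u →
        (u, Y.proj (T ^ θ) v) ∈ D ∧
        g (u, Y.proj (T ^ θ) v) ∈ (X.proj ((T ^ θ) ^ θ ^ 2)).range ∧
        X.nrm σ (g (u, Y.proj (T ^ θ) v)) ≤ ρ * (T ^ θ) ^ β ∧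
        Y.proj ((T ^ θ) ^ θ) (F (g (u, Y.proj (T ^ θ) v))) = Y.proj (T ^ θ) v ∧
        X.nrm s₁ (g (u, Y.proj (T ^ θ) v) - u) ≤ ρ / 4 * (1 / 2) ^ n := by
  have hs₀ := H.s₀_nonneg
  have hm := H.m_nonneg
  have hℓ := H.ℓ_nonneg
  have hℓ' := H.ℓ'_nonneg
  have hS := H.le_S
  have hA := H.one_le_A
  have ha := H.a_pos
  have hb := H.b_pos
  have hσ := H.le_σ
  have hs₁ := H.le_s₁
  have hs₁σ := H.s₁_le
  have hθ := H.one_lt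
  have hmaxm := le_max_left m ℓ
  have hT0 : 0 < T := by linarith
  have hTθ : 1 ≤ T ^ θ := Real.one_le_rpow hT (by linarith)
  have hC0 : 0 < C := by rw [hC]; positivity
  have hTκ0 : 0 < T ^ (-κ) := Real.rpow_pos_of_pos hT0 _
  have hTκ : T ^ κ * T ^ (-κ) = 1 := by
    rw [← Real.rpow_add hT0, add_neg_cancel, Real.rpow_zero]
  have h2n : (1 : ℝ) ≤ 2 ^ n := one_le_pow₀ one_le_two
  have hAAC : 0 < A * C + A := by positivity
  have hbig0 : 16 * a * A ^ 3 * b + 4 * C + 4 * (A * C + A) ≤ T ^ κ :=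
    (le_mul_of_one_le_right (by positivity) h2n).trans hbig
  have habA : 0 < 16 * a * A ^ 3 * b := by positivity
  have hbig1 : 16 * a * A ^ 3 * b ≤ T ^ κ := by linarith
  have hbig2 : 4 * C ≤ T ^ κ := by linarith
  have hbig3 : (A * C + A) * T ^ (-κ) ≤ 1 / 4 * (1 / 2) ^ n := by
    have h1 : 4 * (A * C + A) * 2 ^ n ≤ T ^ κ :=
      le_trans (by gcongr; linarith) hbig
    have h2 : 4 * (A * C + A) * 2 ^ n * T ^ (-κ) ≤ 1 := by
      rw [← hTκ]; gcongr
    have h3 : (1 / 2 : ℝ) ^ n * 2 ^ n = 1 := by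
      rw [← mul_pow]; norm_num
    calc (A * C + A) * T ^ (-κ) =
          1 / 4 * ((1 / 2) ^ n * (4 * (A * C + A) * 2 ^ n * T ^ (-κ))) := by
          linear_combination (-((A * C + A) * T ^ (-κ))) * h3
      _ ≤ 1 / 4 * ((1 / 2) ^ n * 1) := by gcongr
      _ = _ := by rw [mul_one]
  have hpow3 : (T ^ θ) ^ θ ^ 2 = T ^ θ ^ 3 := by
    rw [← Real.rpow_mul hT0.le]; congr 1; ring
  have hpow2 : (T ^ θ) ^ θ = T ^ θ ^ 2 := by
    rw [← Real.rpow_mul hT0.le]; congr 1; ring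
  have hpowβ : (T ^ θ) ^ β = T ^ (θ * β) := (Real.rpow_mul hT0.le _ _).symm
  have hM : 1 ≤ T ^ θ ^ 3 := Real.one_le_rpow hT (by positivity)
  have hM2 : 1 ≤ T ^ θ ^ 2 := Real.one_le_rpow hT (by positivity)
  have hM23 : T ^ θ ^ 2 ≤ T ^ θ ^ 3 :=
    Real.rpow_le_rpow_of_exponent_le hT (pow_le_pow_right₀ hθ.le (by norm_num))
  have hθ2 : T ^ θ ≤ T ^ θ ^ 2 := Real.rpow_le_rpow_of_exponent_le hT (by nlinarith)
  obtain ⟨g, D, hgc, hg⟩ := H.exists_galerkin_solution hT hbig1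
  refine ⟨g, D, hgc, fun ρ u v hρ hρ1 hv hvρ hst => ?_⟩
  rw [hpow3, hpow2, hpowβ]
  have hu := TameScale.range_mono hM2 hM23 hst.mem_range
  have hE : ∀ s, 0 ≤ s → s ≤ S → ∀ u ∈ (X.proj (T ^ θ ^ 3)).range, u ∈ X.space s :=
    fun s h0 h1 u hu => TameScale.mem_space_of_mem_range hM h0 h1 hu
  have hub : u ∈ X.ball (s₀ + m) 1 := ⟨hE _ (by linarith) (by linarith) u hu,
    (X.nrm_mono _ s₁ (by linarith) (by linarith) (by linarith) u
      (hE _ (by linarith) (by linarith) u hu)).trans_lt (by linarith [hst.nrm_s₁_le])⟩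
  have hres := H.residual_le hT hρ hub (hE _ (by linarith) (by linarith) u hu) hst.nrm_σ_le hv hvρ
    hst.solves
  -- Every candidate solution satisfies the estimates claimed for the next stage
  have hcand : ∀ u' ∈ (X.proj (T ^ θ ^ 3)).range, X.mixedNrm T τ s₀ σ (u' - u) ≤ 12 * A ^ 2 * b *
        Y.mixedNrm T τ (s₀ + ℓ') (σ + ℓ') (Y.proj (T ^ θ) v - Y.proj (T ^ θ ^ 2) (F u)) →
      X.nrm s₁ (u' - u) ≤ ρ / 4 * (1 / 2) ^ n ∧ X.nrm σ u' ≤ ρ / 2 * T ^ (θ * β) := by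
    intro u' hu' hQ
    have h1 : X.mixedNrm T τ s₀ σ (u' - u) ≤ C * (ρ * T ^ (-γ)) := by
      refine hQ.trans ?_
      rw [hC, mul_assoc (12 * A ^ 2 * b)]
      gcongr
    have hd := Submodule.sub_mem _ hu' hu
    obtain ⟨h2, h3⟩ := H.correction_le hT hρ hC0.le hbig2
      (hE _ (by linarith) (by linarith) _ hd) h1
    refine ⟨h3.trans ?_, ?_⟩
    · calc (A * C + A) * (ρ * T ^ (-κ)) = ρ * ((A * C + A) * T ^ (-κ)) := by ring
        _ ≤ ρ * (1 / 4 * (1 / 2) ^ n) := by gcongr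
        _ = _ := by ring
    · have h4 := X.nrm_le_add_sub (s := σ) (by linarith) (by linarith)
        (hE _ (by linarith) (by linarith) _ hu) (hE _ (by linarith) (by linarith) _ hu')
      have h5 : X.nrm σ u ≤ 1 / 4 * (ρ * T ^ (θ * β)) := by
        calc X.nrm σ u ≤ ρ * T ^ β := hst.nrm_σ_le
          _ ≤ ρ * T ^ (-κ + θ * β) := by
            gcongr
            linarith [H.growth_lt]
          _ = T ^ (-κ) * (ρ * T ^ (θ * β)) := by rw [Real.rpow_add hT0]; ring
          _ ≤ 1 / 4 * (ρ * T ^ (θ * β)) := by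
            gcongr
            have h6 : (1 : ℝ) * T ^ (-κ) ≤ (A * C + A) * T ^ (-κ) := by
              gcongr
              nlinarith
            have h7 : (1 / 2 : ℝ) ^ n ≤ 1 := pow_le_one₀ (by norm_num) (by norm_num)
            linarith
      linarith
  obtain ⟨h1, h2, h3, h4⟩ := hg u hu (Y.proj (T ^ θ) v)
    (TameScale.range_mono hTθ hθ2 (TameScale.proj_mem_range _ _)) (by
      intro u' hu' hQ
      obtain ⟨h1, h2⟩ := hcand u' hu' hQ
      constructor
      · have h3 := X.nrm_mono (s₀ + max m ℓ) s₁ (by linarith) (by linarith) (by linarith) u'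
          (hE _ (by linarith) (by linarith) _ hu')
        have h4 := X.nrm_le_add_sub (s := s₁) (by linarith) (by linarith)
          (hE _ (by linarith) (by linarith) _ hu) (hE _ (by linarith) (by linarith) _ hu')
        have h5 : (1 / 2 : ℝ) ^ n ≤ 1 := pow_le_one₀ (by norm_num) (by norm_num)
        have h6 : ρ / 4 * (1 / 2) ^ n ≤ ρ / 4 * 1 := by gcongr
        linarith [hst.nrm_s₁_le]
      · refine h2.trans_lt ?_
        exact mul_lt_of_lt_one_left (Real.rpow_pos_of_pos hT0 _) (by linarith))
  obtain ⟨h5, h6⟩ := hcand _ h2 h4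
  refine ⟨h1, h2, h6.trans ?_, h3, h5⟩
  gcongr
  linarith

end GalerkinSetting

/-! ### The scheme and its limit -/

/-- The frequencies `T₀ ^ θ ^ n` grow fast enough to absorb the constant `K` and to make all
errors decay geometrically. -/
theorem exists_frequency {θ κ : ℝ} (hθ : 1 < θ) (hκ : 0 < κ) (K : ℝ) :
    ∃ T₀ : ℝ, 1 ≤ T₀ ∧ ∀ n : ℕ, K * 2 ^ n ≤ (T₀ ^ θ ^ n) ^ κ := by
  have hκθ : 0 < κ * (θ - 1) := mul_pos hκ (by linarith)
  obtain ⟨T₀, h1, h2, h3⟩ := ((eventually_ge_atTop 1).and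
    (((tendsto_rpow_atTop hκ).eventually_ge_atTop K).and
      ((tendsto_rpow_atTop hκθ).eventually_ge_atTop 2))).exists
  have h0 : 0 < T₀ := by linarith
  refine ⟨T₀, h1, fun n => ?_⟩
  induction n with
  | zero => simpa using h2
  | succ n ih =>
    have hT : T₀ ≤ T₀ ^ θ ^ n := Real.self_le_rpow_of_one_le h1 (one_le_pow₀ hθ.le)
    have hT0 : 0 < T₀ ^ θ ^ n := by positivity
    calc K * 2 ^ (n + 1) = K * 2 ^ n * 2 := by ring
      _ ≤ (T₀ ^ θ ^ n) ^ κ * (T₀ ^ θ ^ n) ^ (κ * (θ - 1)) := by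
        gcongr
        exact h3.trans (by gcongr)
      _ = (T₀ ^ θ ^ (n + 1)) ^ κ := by
        rw [← Real.rpow_add hT0, pow_succ, Real.rpow_mul h0.le, ← Real.rpow_mul hT0.le θ κ]
        congr 1; ring

namespace GalerkinSetting

variable {V W : Type*} [NormedAddCommGroup V] [NormedSpace ℝ V]
    [NormedAddCommGroup W] [NormedSpace ℝ W] {S : ℝ} {X : TameScale V S} {Y : TameScale W S}
    {F : V → W} {DF : V → V →ₗ[ℝ] W} {s₀ m ℓ ℓ' s₁ δ θ σ κ γ β τ A a b : ℝ}

/-- The approximate solutions, which depend continuously on the right-hand side. -/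
theorem exists_approximate_solutions
    (H : GalerkinSetting X Y F DF s₀ m ℓ ℓ' s₁ δ θ σ κ γ β τ A a b) :
    ∃ T₀ : ℝ, 1 ≤ T₀ ∧ ∃ u : ℕ → W → V,
      (∀ v, u 0 v = 0) ∧
      (∀ n, ∀ v ∈ Y.ball δ (T₀ ^ (-γ)),
        u n v ∈ X.space s₁ ∧ X.nrm s₁ (u n v) ≤ T₀ ^ γ * Y.nrm δ v / 2 ∧
        X.nrm s₁ (u (n + 1) v - u n v) ≤ T₀ ^ γ * Y.nrm δ v / 4 * (1 / 2) ^ n) ∧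
      (∀ v ∈ Y.ball δ (T₀ ^ (-γ)), Tendsto (fun n => F (u n v)) atTop (𝓝 v)) ∧
      ∀ n, ∀ v ∈ Y.ball δ (T₀ ^ (-γ)), ∀ ε > 0, ∃ η > 0, ∀ v' ∈ Y.ball δ (T₀ ^ (-γ)),
        Y.nrm δ (v' - v) < η → X.nrm s₁ (u n v' - u n v) < ε := by
  have hs₀ := H.s₀_nonneg
  have hm := H.m_nonneg
  have hℓ := H.ℓ_nonneg
  have hℓ' := H.ℓ'_nonneg
  have hS := H.le_S
  have hA := H.one_le_A
  have ha := H.a_pos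
  have hb := H.b_pos
  have hσ := H.le_σ
  have hδ := H.δ_le
  have hs₁ := H.le_s₁
  have hs₁σ := H.s₁_le
  have hθ := H.one_lt
  have hmaxm := le_max_left m ℓ
  have hκγ : κ ≤ γ := by
    have : 0 ≤ θ ^ 3 * ℓ := by positivity
    linarith [H.loss_lt]
  have hγ0 : 0 < γ := H.κ_pos.trans_le hκγ
  have hδ0 : 0 ≤ δ := by linarith [H.γ_eq]
  obtain ⟨C, hC⟩ : ∃ C, C = 12 * A ^ 2 * b * (3 * A + 6 * A * a) := ⟨_, rfl⟩
  have hC0 : 0 < C := by rw [hC]; positivity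
  obtain ⟨T₀, hT₀, hbig⟩ := exists_frequency hθ H.κ_pos
    (16 * a * A ^ 3 * b + 4 * C + 4 * (A * C + A))
  have hT₀0 : 0 < T₀ := by linarith
  obtain ⟨T, hTdef⟩ : ∃ T : ℕ → ℝ, ∀ n, T n = T₀ ^ θ ^ n := ⟨_, fun _ => rfl⟩
  have hT : ∀ n, 1 ≤ T n := fun n => by
    rw [hTdef]; exact Real.one_le_rpow hT₀ (by positivity)
  have hTs : ∀ n, T (n + 1) = T n ^ θ := fun n => by
    rw [hTdef, hTdef, pow_succ, Real.rpow_mul hT₀0.le]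
  have hTdecay : ∀ n, T n ^ (-γ) ≤ (1 / 2) ^ n := by
    intro n
    have hTn := hT n
    have h1 : (2 : ℝ) ^ n ≤ T n ^ κ := by
      rw [hTdef]
      refine le_trans (le_mul_of_one_le_left (by positivity) ?_) (hbig n)
      have h2 : 0 < 16 * a * A ^ 3 * b := by positivity
      have h3 : 0 < A * C := by positivity
      linarith
    calc T n ^ (-γ) ≤ T n ^ (-κ) := Real.rpow_le_rpow_of_exponent_le (hT n) (by linarith)
      _ = (T n ^ κ)⁻¹ := Real.rpow_neg (by linarith) _
      _ ≤ (2 ^ n)⁻¹ := by gcongr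
      _ = (1 / 2) ^ n := by rw [one_div, inv_pow]
  choose g D hgc hg using fun n => H.exists_next_stage hC (hT n) n (by rw [hTdef]; exact hbig n)
  -- Stage `n` runs at frequency `T n`, for all right-hand sides at once; `ρ = T₀ ^ γ * ‖v‖_δ`.
  let u : ℕ → W → V := fun n => Nat.rec (fun _ => 0)
    (fun n w v => g n (w v, Y.proj (T n ^ θ) v)) n
  have hus : ∀ n v, u (n + 1) v = g n (u n v, Y.proj (T n ^ θ) v) := fun _ _ => rfl
  have hTγ : T₀ ^ γ * T₀ ^ (-γ) = 1 := by
    rw [← Real.rpow_add hT₀0, add_neg_cancel, Real.rpow_zero]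
  have hTγ0 : 0 < T₀ ^ γ := by positivity
  have hρ0 : ∀ v ∈ Y.ball δ (T₀ ^ (-γ)), 0 ≤ T₀ ^ γ * Y.nrm δ v := fun v hv =>
    mul_nonneg hTγ0.le (Y.nrm_nonneg hδ0 (by linarith) hv.1)
  have hρ1 : ∀ v ∈ Y.ball δ (T₀ ^ (-γ)), T₀ ^ γ * Y.nrm δ v < 1 := fun v hv => by
    rw [← hTγ]
    have := hv.2
    gcongr
  have hvρ : ∀ v ∈ Y.ball δ (T₀ ^ (-γ)), Y.nrm δ v ≤ T₀ ^ γ * Y.nrm δ v := fun v hv =>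
    le_mul_of_one_le_left (Y.nrm_nonneg hδ0 (by linarith) hv.1)
      (Real.one_le_rpow hT₀ hγ0.le)
  have hstage : ∀ n, ∀ v ∈ Y.ball δ (T₀ ^ (-γ)),
      Stage X Y F s₁ δ θ σ γ β (T n) (T₀ ^ γ * Y.nrm δ v) v (u n v) ∧
      X.nrm s₁ (u n v) ≤ T₀ ^ γ * Y.nrm δ v / 2 * (1 - (1 / 2) ^ n) := by
    intro n v hv
    have hρ := hρ0 v hv
    induction n with
    | zero =>
      have hz1 : X.nrm s₁ (u 0 v) = 0 := X.nrm_zero_vec (by linarith) (by linarith)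
      have hz2 : X.nrm σ (u 0 v) = 0 := X.nrm_zero_vec (by linarith) (by linarith)
      refine ⟨⟨Submodule.zero_mem _, by rw [hz1]; positivity, ?_, Or.inr ⟨rfl, ?_⟩⟩, ?_⟩
      · have := hT 0
        rw [hz2]; positivity
      · rw [hTdef, pow_zero, Real.rpow_one, mul_right_comm, hTγ, one_mul]
      · rw [hz1]; simp
    | succ n ih =>
      obtain ⟨-, h2, h3, h4, h5⟩ := hg n _ _ v hρ (hρ1 v hv) hv.1 (hvρ v hv) ih.1
      rw [← hus] at h2 h3 h4 h5
      rw [← hTs] at h2 h3 h4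
      have hm1 : u n v ∈ X.space s₁ := TameScale.mem_space_of_mem_range
        (Real.one_le_rpow (hT n) (by positivity)) (by linarith) (by linarith) ih.1.mem_range
      have hm2 : u (n + 1) v ∈ X.space s₁ := TameScale.mem_space_of_mem_range
        (Real.one_le_rpow (hT (n + 1)) (by positivity)) (by linarith) (by linarith) h2
      have h6 := X.nrm_le_add_sub (by linarith) (by linarith) hm1 hm2
      have h7 : X.nrm s₁ (u (n + 1) v) ≤ T₀ ^ γ * Y.nrm δ v / 2 * (1 - (1 / 2) ^ (n + 1)) := by
        have e : T₀ ^ γ * Y.nrm δ v / 2 * (1 - (1 / 2) ^ (n + 1)) =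
            T₀ ^ γ * Y.nrm δ v / 2 * (1 - (1 / 2) ^ n) +
              T₀ ^ γ * Y.nrm δ v / 4 * (1 / 2) ^ n := by ring
        rw [e]
        linarith [ih.2]
      refine ⟨⟨h2, h7.trans ?_, h3, Or.inl h4⟩, h7⟩
      have h8 : (0 : ℝ) < (1 / 2) ^ (n + 1) := by positivity
      exact mul_le_of_le_one_right (by positivity) (by linarith)
  have hmem : ∀ n, ∀ v ∈ Y.ball δ (T₀ ^ (-γ)), ∀ s, 0 ≤ s → s ≤ S → u n v ∈ X.space s :=
    fun n v hv s h0 h1 => TameScale.mem_space_of_mem_range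
      (Real.one_le_rpow (hT n) (by positivity)) h0 h1 (hstage n v hv).1.mem_range
  have huc : ∀ n, ContinuousOn (u n) (Y.ball δ (T₀ ^ (-γ))) := by
    intro n
    induction n with
    | zero => exact continuousOn_const
    | succ n ih =>
      exact (hgc n).comp (ih.prodMk (Y.proj (T n ^ θ)).continuous.continuousOn)
        fun v hv => (hg n _ _ v (hρ0 v hv) (hρ1 v hv) hv.1 (hvρ v hv) (hstage n v hv).1).1
  refine ⟨T₀, hT₀, u, fun _ => rfl, fun n v hv => ⟨hmem n v hv s₁ (by linarith) (by linarith),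
    (hstage n v hv).1.nrm_s₁_le, (hg n _ _ v (hρ0 v hv) (hρ1 v hv) hv.1 (hvρ v hv)
      (hstage n v hv).1).2.2.2.2⟩, fun v hv => ?_, fun n v hv ε hε => ?_⟩
  · rw [← tendsto_add_atTop_iff_nat 1, tendsto_iff_norm_sub_tendsto_zero]
    have hlim : Tendsto (fun n : ℕ => (2 * A * a + A) *
        (T₀ ^ γ * Y.nrm δ v * (1 / 2) ^ (n + 1))) atTop (𝓝 0) := by
      have h1 : Tendsto (fun n : ℕ => (1 / 2 : ℝ) ^ (n + 1)) atTop (𝓝 0) :=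
        (tendsto_add_atTop_iff_nat 1).2
          (tendsto_pow_atTop_nhds_zero_of_lt_one (by norm_num) (by norm_num))
      simpa using (h1.const_mul (T₀ ^ γ * Y.nrm δ v)).const_mul (2 * A * a + A)
    refine squeeze_zero (fun _ => norm_nonneg _) (fun n => ?_) hlim
    have hst := (hstage (n + 1) v hv).1
    obtain ⟨-, -, -, h4, -⟩ := hg n _ _ v (hρ0 v hv) (hρ1 v hv) hv.1 (hvρ v hv)
      (hstage n v hv).1
    rw [← hus, ← hTs] at h4
    have hmono := X.nrm_mono (s₀ + m) s₁ (by linarith) (by linarith) (by linarith) _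
      (hmem (n + 1) v hv s₁ (by linarith) (by linarith))
    have hub : u (n + 1) v ∈ X.ball (s₀ + m) 1 :=
      ⟨hmem (n + 1) v hv (s₀ + m) (by linarith) (by linarith),
        by linarith [hst.nrm_s₁_le, hρ1 v hv, hρ0 v hv]⟩
    -- `Π'(Λ) w → w` may fail in `W_{s₀}`, so the high frequencies of `F (u_n)` are estimated
    -- through the `σ`-norm of `u_n`.
    have h5 := H.nrm_sub_proj_map_le (hT (n + 1)) le_rfl (hρ0 v hv) le_rfl (by linarith) hub
      (hmem (n + 1) v hv σ (by linarith) (by linarith)) hst.nrm_σ_le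
    have h6 := H.nrm_sub_proj_le (hT (n + 1)) le_rfl le_rfl (by linarith) hv.1 (hvρ v hv)
    rw [Y.nrm_zero] at h5 h6
    rw [h4] at h5
    have e : F (u (n + 1) v) - v =
      (F (u (n + 1) v) - Y.proj (T (n + 1)) v) - (v - Y.proj (T (n + 1)) v) := by abel
    rw [e]
    calc _ ≤ _ := norm_sub_le _ _
      _ ≤ 2 * A * a * (T₀ ^ γ * Y.nrm δ v * T (n + 1) ^ (-γ)) +
          A * (T₀ ^ γ * Y.nrm δ v * T (n + 1) ^ (-γ)) := add_le_add h5 h6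
      _ = (2 * A * a + A) * (T₀ ^ γ * Y.nrm δ v * T (n + 1) ^ (-γ)) := by ring
      _ ≤ _ := by
        have := hρ0 v hv
        gcongr
        exact hTdecay (n + 1)
  · have hM : 1 ≤ T n ^ θ ^ 2 := Real.one_le_rpow (hT n) (by positivity)
    have hK : 0 < A * (T n ^ θ ^ 2) ^ s₁ := by positivity
    obtain ⟨η, hη, hc⟩ := Metric.continuousOn_iff.1 (huc n) v hv (ε / (A * (T n ^ θ ^ 2) ^ s₁))
      (by positivity)
    refine ⟨η, hη, fun v' hv' hd => ?_⟩
    have h1 := hc v' hv' (by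
      rw [dist_eq_norm]
      exact (Y.norm_le_nrm hδ0 (by linarith) (Submodule.sub_mem _ hv'.1 hv.1)).trans_lt hd)
    have h2 := TameScale.nrm_le_of_mem_range H.constX hM le_rfl (t := s₁) (by linarith)
      (by linarith) (Submodule.sub_mem _ (hstage n v' hv').1.mem_range
        (hstage n v hv).1.mem_range)
    rw [X.nrm_zero, sub_zero] at h2
    rw [dist_eq_norm, lt_div_iff₀ hK, mul_comm] at h1
    exact h2.trans_lt h1

/-- The limit of the approximate solutions is a continuous right inverse of `F`. -/
theorem exists_continuous_right_inverse
    (H : GalerkinSetting X Y F DF s₀ m ℓ ℓ' s₁ δ θ σ κ γ β τ A a b) :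
    ∃ r : ℝ, 0 < r ∧ ∃ G : W → V,
      (∀ v ∈ Y.ball δ r, G v ∈ X.ball s₁ 1) ∧
      (∀ v ∈ Y.ball δ r, ∀ ε > 0, ∃ η > 0, ∀ v' ∈ Y.ball δ r,
        Y.nrm δ (v' - v) < η → X.nrm s₁ (G v' - G v) < ε) ∧
      G 0 = 0 ∧
      (∀ v ∈ Y.ball δ r, F (G v) = v) ∧
      (∀ v ∈ Y.ball δ r, X.nrm s₁ (G v) ≤ r⁻¹ * Y.nrm δ v) := by
  have hs₀ := H.s₀_nonneg
  have hm := H.m_nonneg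
  have hℓ := H.ℓ_nonneg
  have hℓ' := H.ℓ'_nonneg
  have hS := H.le_S
  have ha := H.a_pos
  have hσ := H.le_σ
  have hδ := H.δ_le
  have hs₁ := H.le_s₁
  have hs₁σ := H.s₁_le
  have hθ := H.one_lt
  have hmaxm := le_max_left m ℓ
  have hγ0 : 0 < γ := by
    have : 0 ≤ θ ^ 3 * ℓ := by positivity
    linarith [H.loss_lt, H.κ_pos]
  have hδ0 : 0 ≤ δ := by linarith [H.γ_eq]
  have h0 : 0 ≤ s₁ := by linarith
  have h1 : s₁ ≤ S := by linarith
  obtain ⟨T₀, hT₀, u, hu0, hu, hFu, huc⟩ := H.exists_approximate_solutions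
  have hT₀0 : 0 < T₀ := by linarith
  have hr : 0 < T₀ ^ (-γ) := by positivity
  have hrinv : (T₀ ^ (-γ))⁻¹ = T₀ ^ γ := by rw [Real.rpow_neg hT₀0.le, inv_inv]
  set r := T₀ ^ (-γ)
  rw [← hrinv] at hu
  have hρ0 : ∀ v ∈ Y.ball δ r, 0 ≤ r⁻¹ * Y.nrm δ v := fun v hv =>
    mul_nonneg (by positivity) (Y.nrm_nonneg hδ0 (by linarith) hv.1)
  have hρ1 : ∀ v ∈ Y.ball δ r, r⁻¹ * Y.nrm δ v < 1 := fun v hv => by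
    rw [inv_mul_lt_iff₀ hr, mul_one]
    exact hv.2
  have hcau : ∀ v ∈ Y.ball δ r, ∀ n k, X.nrm s₁ (u (n + k) v - u n v) ≤
      r⁻¹ * Y.nrm δ v / 2 * (1 / 2) ^ n * (1 - (1 / 2) ^ k) := by
    intro v hv n k
    induction k with
    | zero => simp [X.nrm_zero_vec h0 h1]
    | succ k ih =>
      have e : u (n + (k + 1)) v - u n v =
        (u (n + k + 1) v - u (n + k) v) + (u (n + k) v - u n v) := by
          rw [← add_assoc]; abel
      rw [e]
      have h2 := X.nrm_add_le s₁ h0 h1 _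
        (Submodule.sub_mem _ (hu (n + k + 1) v hv).1 (hu (n + k) v hv).1) _
        (Submodule.sub_mem _ (hu (n + k) v hv).1 (hu n v hv).1)
      have e2 : r⁻¹ * Y.nrm δ v / 2 * (1 / 2) ^ n * (1 - (1 / 2) ^ (k + 1)) =
          r⁻¹ * Y.nrm δ v / 4 * (1 / 2) ^ (n + k) +
            r⁻¹ * Y.nrm δ v / 2 * (1 / 2) ^ n * (1 - (1 / 2) ^ k) := by ring
      rw [e2]
      linarith [(hu (n + k) v hv).2.2]
  have hcau' : ∀ v ∈ Y.ball δ r, ∀ n k, X.nrm s₁ (u (n + k) v - u n v) ≤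
      r⁻¹ * Y.nrm δ v / 2 * (1 / 2) ^ n := by
    intro v hv n k
    have := hρ0 v hv
    refine (hcau v hv n k).trans (mul_le_of_le_one_right (by positivity) ?_)
    have : (0 : ℝ) < (1 / 2) ^ k := by positivity
    linarith
  have hpow : ∀ ε > 0, ∃ n : ℕ, (1 / 2 : ℝ) ^ n < ε := fun ε hε =>
    exists_pow_lt_of_lt_one hε (by norm_num)
  have hlim : ∀ v, ∃ y, v ∈ Y.ball δ r → y ∈ X.space s₁ ∧
      Tendsto (fun n => X.nrm s₁ (u n v - y)) atTop (𝓝 0) := by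
    intro v
    by_cases hv : v ∈ Y.ball δ r
    · obtain ⟨y, hy, hy'⟩ := X.complete s₁ h0 h1 (fun n => u n v) (fun n => (hu n v hv).1) (by
        intro ε hε
        obtain ⟨N, hN⟩ := hpow ε hε
        refine ⟨N, fun p hp q hq => ?_⟩
        obtain ⟨p, rfl⟩ := Nat.exists_eq_add_of_le hp
        obtain ⟨q, rfl⟩ := Nat.exists_eq_add_of_le hq
        have e : u (N + p) v - u (N + q) v = (u (N + p) v - u N v) - (u (N + q) v - u N v) := by
          abel
        rw [e]
        have h2 := X.nrm_sub_le h0 h1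
          (Submodule.sub_mem _ (hu (N + p) v hv).1 (hu N v hv).1)
          (Submodule.sub_mem _ (hu (N + q) v hv).1 (hu N v hv).1)
        have h3 := hcau' v hv N p
        have h4 := hcau' v hv N q
        have h5 : r⁻¹ * Y.nrm δ v * (1 / 2) ^ N ≤ 1 * (1 / 2) ^ N := by
          have := hρ1 v hv
          gcongr
        linarith)
      exact ⟨y, fun _ => ⟨hy, hy'⟩⟩
    · exact ⟨0, fun h => absurd h hv⟩
  choose G hG using hlim
  have htail : ∀ v ∈ Y.ball δ r, ∀ n, X.nrm s₁ (G v - u n v) ≤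
      r⁻¹ * Y.nrm δ v / 2 * (1 / 2) ^ n := by
    intro v hv n
    obtain ⟨hy, hy'⟩ := hG v hv
    have h2 : Tendsto (fun k => X.nrm s₁ (u (k + n) v - G v) +
        r⁻¹ * Y.nrm δ v / 2 * (1 / 2) ^ n) atTop
        (𝓝 (0 + r⁻¹ * Y.nrm δ v / 2 * (1 / 2) ^ n)) :=
      ((tendsto_add_atTop_iff_nat n).2 hy').add_const _
    rw [zero_add] at h2
    refine ge_of_tendsto' h2 fun k => ?_
    have e : G v - u n v = (u (k + n) v - u n v) - (u (k + n) v - G v) := by abel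
    rw [e]
    have h3 := X.nrm_sub_le h0 h1
      (Submodule.sub_mem _ (hu (k + n) v hv).1 (hu n v hv).1)
      (Submodule.sub_mem _ (hu (k + n) v hv).1 hy)
    have h4 := hcau' v hv n k
    rw [add_comm n k] at h4
    linarith
  have hbound : ∀ v ∈ Y.ball δ r, X.nrm s₁ (G v) ≤ r⁻¹ * Y.nrm δ v := by
    intro v hv
    have h2 := htail v hv 0
    rw [hu0, sub_zero, pow_zero, mul_one] at h2
    linarith [hρ0 v hv]
  have hball : ∀ v ∈ Y.ball δ r, G v ∈ X.ball s₁ 1 := fun v hv =>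
    ⟨(hG v hv).1, (hbound v hv).trans_lt (hρ1 v hv)⟩
  have hsub : ∀ {w : V}, w ∈ X.ball s₁ 1 → w ∈ X.ball (s₀ + m) 1 := fun {w} hw =>
    ⟨X.space_anti _ s₁ (by linarith) (by linarith) h1 hw.1,
      (X.nrm_mono _ s₁ (by linarith) (by linarith) h1 w hw.1).trans_lt hw.2⟩
  refine ⟨r, hr, G, hball, ?_, ?_, ?_, hbound⟩
  · intro v hv ε hε
    obtain ⟨n, hn⟩ := hpow (ε / 2) (by positivity)
    obtain ⟨η, hη, hc⟩ := huc n v hv (ε / 2) (by positivity)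
    refine ⟨η, hη, fun v' hv' hd => ?_⟩
    have hsmall : ∀ w ∈ Y.ball δ r, X.nrm s₁ (G w - u n w) ≤ 1 / 2 * (1 / 2) ^ n := by
      intro w hw
      refine (htail w hw n).trans ?_
      have := hρ1 w hw
      gcongr
    have m1 := Submodule.sub_mem _ (hG v' hv').1 (hu n v' hv').1
    have m2 := Submodule.sub_mem _ (hu n v' hv').1 (hu n v hv).1
    have m3 := Submodule.sub_mem _ (hG v hv).1 (hu n v hv).1
    have e : G v' - G v = ((G v' - u n v') + (u n v' - u n v)) - (G v - u n v) := by abel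
    rw [e]
    have h2 := X.nrm_sub_le h0 h1 (Submodule.add_mem _ m1 m2) m3
    have h3 := X.nrm_add_le s₁ h0 h1 _ m1 _ m2
    linarith [hsmall v hv, hsmall v' hv', hc v' hv' hd]
  · have hz : (0 : W) ∈ Y.ball δ r :=
      ⟨Submodule.zero_mem _, by rw [Y.nrm_zero_vec hδ0 (by linarith)]; exact hr⟩
    have h2 := hbound 0 hz
    rw [Y.nrm_zero_vec hδ0 (by linarith), mul_zero] at h2
    exact norm_le_zero_iff.1 ((X.norm_le_nrm h0 h1 (hG 0 hz).1).trans h2)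
  · intro v hv
    obtain ⟨hy, hy'⟩ := hG v hv
    refine tendsto_nhds_unique ?_ (hFu v hv)
    rw [tendsto_iff_norm_sub_tendsto_zero]
    have h2 : Tendsto (fun n => 2 * a * X.nrm s₁ (u n v - G v)) atTop (𝓝 0) := by
      simpa using hy'.const_mul (2 * a)
    refine squeeze_zero (fun _ => norm_nonneg _) (fun n => ?_) h2
    have hun : u n v ∈ X.ball (s₀ + m) 1 :=
      hsub ⟨(hu n v hv).1, by linarith [(hu n v hv).2.1, hρ1 v hv, hρ0 v hv]⟩
    have hGv := hsub (hball v hv)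
    have h3 := H.gdiff.nrm_sub_le_of_tameDirect ha H.direct hs₀ hm (by linarith) hGv hun
    have h4 := Y.norm_le_nrm hs₀ (by linarith)
      (Submodule.sub_mem _ (H.gdiff.maps _ hun) (H.gdiff.maps _ hGv))
    have h5 := X.nrm_mono (s₀ + m) s₁ (by linarith) (by linarith) h1 _
      (Submodule.sub_mem _ (hu n v hv).1 hy)
    exact (h4.trans h3).trans (by gcongr)

end GalerkinSetting

/-! ### Choice of the exponents -/

/-- Exponents exist: take `θ > 1` close to `1`, which is possible because `s₁ - s₀ < γ`, then
`σ` large. -/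
theorem exists_galerkinExponents {s₀ m ℓ ℓ' s₁ δ : ℝ} (hs₀ : 0 ≤ s₀) (hm : 0 ≤ m) (hℓ : 0 ≤ ℓ)
    (hℓ' : 0 ≤ ℓ') (hs₁ : s₀ + max m ℓ ≤ s₁) (hδ : s₁ + ℓ' < δ) :
    ∃ θ σ κ γ β τ, GalerkinExponents s₀ m ℓ ℓ' s₁ δ θ σ κ γ β τ := by
  have hmaxm := le_max_left m ℓ
  have hmaxℓ := le_max_right m ℓ
  obtain ⟨γ, hγ⟩ : ∃ γ, γ = δ - s₀ - ℓ' := ⟨_, rfl⟩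
  obtain ⟨θ, hθ, hθγ⟩ : ∃ θ : ℝ, 1 < θ ∧ θ ^ 3 * (s₁ - s₀) < γ := by
    have hc : ContinuousAt (fun x : ℝ => x ^ 3 * (s₁ - s₀)) 1 := by fun_prop
    have h1 : ∀ᶠ x in 𝓝[>] (1 : ℝ), x ^ 3 * (s₁ - s₀) < γ :=
      (hc.eventually_lt_const (by linarith)).filter_mono nhdsWithin_le_nhds
    have h2 : ∀ᶠ x in 𝓝[>] (1 : ℝ), 1 < x := self_mem_nhdsWithin
    exact (h2.and h1).exists
  obtain ⟨κ, hκ⟩ : ∃ κ, κ = γ - θ ^ 3 * (s₁ - s₀) := ⟨_, rfl⟩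
  have hθ0 : 0 < θ := by linarith
  have h12 : θ < θ ^ 2 := by nlinarith
  have h23 : θ ^ 2 < θ ^ 3 := by nlinarith
  have hlarge : ∀ c₁ c₀ : ℝ, 0 < c₁ → ∀ᶠ σ in atTop, c₀ ≤ c₁ * σ := fun c₁ c₀ h =>
    (tendsto_id.const_mul_atTop h).eventually_ge_atTop c₀
  obtain ⟨σ, ⟨⟨p1, p2⟩, p3, p4⟩, ⟨p5, p6⟩, p7, p8, p9⟩ :=
    ((((hlarge (θ - 1) (2 * γ + ℓ' + θ * (m + s₀ + ℓ')) (by linarith)).and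
      (hlarge (θ - 1) (θ ^ 2 * (ℓ' + m) + γ + (γ + ℓ') - θ * (γ + ℓ') - θ ^ 3 * ℓ)
        (by linarith))).and
      ((hlarge (θ ^ 3 - θ) (θ ^ 2 * ℓ' + θ * (γ + ℓ') + θ ^ 3 * ℓ + κ + θ ^ 3 * (s₀ + m))
        (by linarith)).and
      (hlarge (θ ^ 3 - θ ^ 2) (θ ^ 2 * (ℓ' - s₀) + κ + θ ^ 3 * (s₀ + m)) (by linarith)))).and
      (((hlarge (θ ^ 2 - θ) (θ * (γ + ℓ') + κ + θ ^ 2 * s₁) (by linarith)).and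
      (hlarge (θ - 1) (κ - (θ - 1) * (γ + ℓ')) (by linarith))).and
      ((eventually_ge_atTop s₁).and ((eventually_ge_atTop δ).and
        (eventually_ge_atTop (s₀ + m + ℓ')))))).exists
  have hγ0 : 0 < γ := by linarith
  refine ⟨θ, σ, κ, γ, σ + γ + ℓ', θ * (σ + γ + ℓ') + θ ^ 3 * ℓ, ⟨hs₀, hm, hℓ, hℓ', hs₁, p7, p8, p9,
    hθ, by linarith, hγ, rfl, ?_, ?_, ?_, ?_, ?_, ?_, ?_, ?_, ?_⟩⟩
  · linarith
  · linarith
  · have : 0 ≤ θ ^ 3 * ℓ := by positivity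
    nlinarith
  · linarith
  · linarith
  · have : θ ^ 3 * ℓ ≤ θ ^ 3 * (s₁ - s₀) := by gcongr; linarith
    linarith
  · have : θ ^ 2 * (s₁ - s₀) ≤ θ ^ 3 * (s₁ - s₀) := by
      have : 0 ≤ s₁ - s₀ := by linarith
      gcongr
    linarith
  · linarith
  · linarith

theorem theorem3 (s₀ m ℓ ℓ' s₁ δ : ℝ) (hs₀ : 0 ≤ s₀) (hm : 0 ≤ m) (hℓ : 0 ≤ ℓ) (hℓ' : 0 ≤ ℓ')
    (hs₁ : s₀ + max m ℓ ≤ s₁) (hδ : s₁ + ℓ' < δ) :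
    ∃ S₀ : ℝ, ∀ S : ℝ, S₀ ≤ S →
      ∀ (V W : Type*) [NormedAddCommGroup V] [NormedSpace ℝ V]
        [NormedAddCommGroup W] [NormedSpace ℝ W]
        (X : TameScale V S) (Y : TameScale W S) (F : V → W) (DF : V → V →ₗ[ℝ] W),
        F 0 = 0 →
        STameDifferentiable X.toBanachScale Y.toBanachScale s₀ m F DF →
        TameRightInvertible X.toBanachScale Y.toBanachScale s₀ m ℓ ℓ' DF →
        ProjectedDerivContinuous X Y s₀ m ℓ DF →
        ∃ r : ℝ, 0 < r ∧ ∃ G : W → V,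
          (∀ v ∈ Y.ball δ r, G v ∈ X.ball s₁ 1) ∧
          (∀ v ∈ Y.ball δ r, ∀ ε > 0, ∃ η > 0, ∀ v' ∈ Y.ball δ r,
            Y.nrm δ (v' - v) < η → X.nrm s₁ (G v' - G v) < ε) ∧
          G 0 = 0 ∧
          (∀ v ∈ Y.ball δ r, F (G v) = v) ∧
          (∀ v ∈ Y.ball δ r, X.nrm s₁ (G v) ≤ r⁻¹ * Y.nrm δ v) := by
  obtain ⟨θ, σ, κ, γ, β, τ, hexp⟩ := exists_galerkinExponents hs₀ hm hℓ hℓ' hs₁ hδ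
  refine ⟨σ + m + ℓ + ℓ', ?_⟩
  intro S hS V W _ _ _ _ X Y F DF hF0 hF hinv hcont
  obtain ⟨A₁, hA₁, hX⟩ := X.exists_hasConst
  obtain ⟨A₂, hA₂, hY⟩ := Y.exists_hasConst
  obtain ⟨a, ha, hdirect⟩ := hF.tame_direct
  obtain ⟨b, hb, hinverse⟩ := hinv
  exact GalerkinSetting.exists_continuous_right_inverse (A := max A₁ A₂) (a := a) (b := b)
    { toGalerkinExponents := hexp
      le_S := hS
      one_le_A := hA₁.trans (le_max_left _ _)
      constX := hX _ (le_max_left _ _)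
      constY := hY _ (le_max_right _ _)
      a_pos := ha
      b_pos := hb
      F_zero := hF0
      gdiff := hF.toGDifferentiable
      direct := hdirect
      inverse := hinverse
      proj_cont := hcont }
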